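/- Let $M$ be a hyperkähler 4-manifold with Riemannian metric $g_0$, complex structures $J_1,J_2,J_3$ satisfying $J_1J_2=J_3$, and Kähler forms $\omega_i=g_0(J_i\,\cdot,\cdot)$. Let $\pi:P\to M$ be a principal $S^1$-bundle with a connection 1-form $\xi$ such that $d\xi=\pi^*\omega_1$, put $N=\mathbb{R}^+\times P$ with $t>0$ the coordinate on $\mathbb{R}^+$, and let $Y\to N$ be a principal $S^1$-bundle with a connection 1-form $\eta$ such that $d\eta=-\omega_2$, where $\omega_2$ is pulled back to $Y$. (Connection forms are real valued, invariant, and equal to $1$ on the generator of the action $\theta\mapsto e^{i\theta}$; such $P,\xi,Y,\eta$ can be found when $[\omega_1/2\pi]$ and $[\omega_2/2\pi]$ are integral classes.) Then, with all forms pulled back to the 7-manifold $Y$, the 3-form $$\varphi=t\,\omega_1\wedge\eta+dt\wedge\xi\wedge\eta+t^4\,\omega_3\wedge dt+t\,\omega_2\wedge\xi$$ defines a torsion-free $G_2$ structure on $Y$ (that is, it is a smooth form, at every point it is the standard $G_2$ form in a suitable coframe, and $\varphi$ and $*\varphi$ are both closed). The dual 4-form is $$*\varphi=\omega_3\wedge\xi\wedge\eta-t^3\,\omega_2\wedge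 dt\wedge\eta+t^3\,\omega_1\wedge dt\wedge\xi+\tfrac12t^4\,\omega_1\wedge\omega_1,$$ and the metric determined by $\varphi$ is the Gibbons–Lü–Pope–Stelle metric $$k=t^2g_0+t^{-2}\,\xi\otimes\xi+t^{-2}\,\eta\otimes\eta+t^4\,dt\otimes dt.$$ -/

import Mathlib

open scoped Manifold ContDiff

noncomputable section

/-! ### Exterior algebra of continuous alternating forms -/

section Wedge

variable {V : Type*} [AddCommGroup V] [Module ℝ V] [TopologicalSpace V]

/-- The multilinear map `(v₁, …, v_{k+l}) ↦ α(v₁, …, v_k) β(v_{k+1}, …, v_{k+l})`. -/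
def formTensor {k l : ℕ} (α : V [⋀^Fin k]→L[ℝ] ℝ) (β : V [⋀^Fin l]→L[ℝ] ℝ) :
    ContinuousMultilinearMap ℝ (fun _ : Fin (k + l) => V) ℝ where
  toMultilinearMap :=
    ((LinearMap.mul' ℝ ℝ).compMultilinearMap
      (α.toMultilinearMap.domCoprod β.toMultilinearMap)).domDomCongr finSumFinEquiv
  cont := by
    have h : Continuous fun v : Fin (k + l) → V =>
        α (fun i => v (Fin.castAdd l i)) * β (fun j => v (Fin.natAdd k j)) :=
      (α.cont.comp (continuous_pi fun i => continuous_apply _)).mul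
        (β.cont.comp (continuous_pi fun j => continuous_apply _))
    exact h

theorem formTensor_apply {k l : ℕ} (α : V [⋀^Fin k]→L[ℝ] ℝ) (β : V [⋀^Fin l]→L[ℝ] ℝ)
    (v : Fin (k + l) → V) :
    formTensor α β v
      = α (fun i => v (Fin.castAdd l i)) * β (fun j => v (Fin.natAdd k j)) := rfl

/-- The wedge product
`(α ∧ β)(v) = (1 / (k! l!)) ∑_σ sign(σ) α(v_{σ1}, …, v_{σk}) β(v_{σ(k+1)}, …, v_{σ(k+l)})`. -/
def wedge {k l : ℕ} (α : V [⋀^Fin k]→L[ℝ] ℝ) (β : V [⋀^Fin l]→L[ℝ] ℝ) :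
    V [⋀^Fin (k + l)]→L[ℝ] ℝ :=
  ((k.factorial : ℝ) * (l.factorial : ℝ))⁻¹ •
    ContinuousMultilinearMap.alternatization (formTensor α β)

/-- A continuous linear functional as an alternating form of degree one. -/
def oneForm (a : V →L[ℝ] ℝ) : V [⋀^Fin 1]→L[ℝ] ℝ :=
  ContinuousAlternatingMap.ofSubsingleton ℝ V ℝ 0 a

end Wedge

/-! ### Differential forms on manifolds modelled on a normed space -/

section Forms

variable {E : Type*} [NormedAddCommGroup E] [NormedSpace ℝ E]
  {M : Type*} [TopologicalSpace M] [ChartedSpace E M]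
  {F : Type*} [NormedAddCommGroup F] [NormedSpace ℝ F]
  {N : Type*} [TopologicalSpace N] [ChartedSpace F N]

/-- Fields of alternating `k`-forms on the tangent spaces of `M`. -/
abbrev DForm (E : Type*) [NormedAddCommGroup E] [NormedSpace ℝ E]
    (M : Type*) [TopologicalSpace M] [ChartedSpace E M] (k : ℕ) : Type _ :=
  (x : M) → TangentSpace 𝓘(ℝ, E) x [⋀^Fin k]→L[ℝ] ℝ

/-- The pullback `f^* α`. -/
def DForm.pullback {k : ℕ} (f : M → N) (α : DForm F N k) : DForm E M k := fun x =>
  (α (f x)).compContinuousLinearMap (mfderiv 𝓘(ℝ, E) 𝓘(ℝ, F) f x)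

/-- The expression of `α` in the preferred chart at `x₀`, a form on the model space
(meaningful on the target of the chart). -/
def DForm.inChart {k : ℕ} (α : DForm E M k) (x₀ : M) : E → E [⋀^Fin k]→L[ℝ] ℝ := fun y =>
  (α ((extChartAt 𝓘(ℝ, E) x₀).symm y)).compContinuousLinearMap
    (mfderiv 𝓘(ℝ, E) 𝓘(ℝ, E) (extChartAt 𝓘(ℝ, E) x₀).symm y)

/-- A form is smooth if all its chart expressions are. -/
def DForm.IsSmooth {k : ℕ} (α : DForm E M k) : Prop :=
  ∀ x₀ : M, ContDiffOn ℝ ∞ (α.inChart x₀) (extChartAt 𝓘(ℝ, E) x₀).target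

/-- The exterior derivative, computed at `x` in the preferred chart at `x`. -/
def DForm.d {k : ℕ} (α : DForm E M k) : DForm E M (k + 1) := fun x =>
  (extDeriv (α.inChart x) (extChartAt 𝓘(ℝ, E) x x)).compContinuousLinearMap
    (mfderiv 𝓘(ℝ, E) 𝓘(ℝ, E) (extChartAt 𝓘(ℝ, E) x) x)

/-- The differential `df` of a real function as a form of degree one. -/
def DForm.ofFun (f : M → ℝ) : DForm E M 1 := fun x =>
  oneForm (mfderiv 𝓘(ℝ, E) 𝓘(ℝ, ℝ) f x : TangentSpace 𝓘(ℝ, E) x →L[ℝ] ℝ)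

end Forms

/-! ### Hyperkähler 4-manifolds -/

/-- A hyperkähler structure on a 4-manifold: a Riemannian metric `g` with orthogonal almost complex
structures `J₁, J₂, J₃` satisfying the quaternion relations, such that the fundamental forms
`ωᵢ = g(Jᵢ ·, ·)` are smooth and closed. (Closedness of the three forms is equivalent to the `Jᵢ`
being parallel for the Levi-Civita connection, and it implies that they are integrable. Smoothness
of the `ωᵢ` amounts to smoothness of the `Jᵢ`.) -/
structure HyperkahlerStructure (M : Type*) [TopologicalSpace M]
    [ChartedSpace (EuclideanSpace ℝ (Fin 4)) M] [IsManifold (𝓡 4) ∞ M] where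
  /-- the Riemannian metric -/
  g : Bundle.ContMDiffRiemannianMetric (𝓡 4) ∞ (EuclideanSpace ℝ (Fin 4))
    (fun x : M => TangentSpace (𝓡 4) x)
  /-- the first complex structure -/
  J₁ : (x : M) → TangentSpace (𝓡 4) x →L[ℝ] TangentSpace (𝓡 4) x
  /-- the second complex structure -/
  J₂ : (x : M) → TangentSpace (𝓡 4) x →L[ℝ] TangentSpace (𝓡 4) x
  /-- the third complex structure -/
  J₃ : (x : M) → TangentSpace (𝓡 4) x →L[ℝ] TangentSpace (𝓡 4) x
  /-- the first Kähler form -/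
  ω₁ : DForm (EuclideanSpace ℝ (Fin 4)) M 2
  /-- the second Kähler form -/
  ω₂ : DForm (EuclideanSpace ℝ (Fin 4)) M 2
  /-- the third Kähler form -/
  ω₃ : DForm (EuclideanSpace ℝ (Fin 4)) M 2
  sq_J₁ : ∀ x u, J₁ x (J₁ x u) = -u
  sq_J₂ : ∀ x u, J₂ x (J₂ x u) = -u
  sq_J₃ : ∀ x u, J₃ x (J₃ x u) = -u
  J₁_J₂ : ∀ x u, J₁ x (J₂ x u) = J₃ x u
  orthogonal_J₁ : ∀ x u v, g.inner x (J₁ x u) (J₁ x v) = g.inner x u v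
  orthogonal_J₂ : ∀ x u v, g.inner x (J₂ x u) (J₂ x v) = g.inner x u v
  orthogonal_J₃ : ∀ x u v, g.inner x (J₃ x u) (J₃ x v) = g.inner x u v
  ω₁_apply : ∀ x u v, ω₁ x ![u, v] = g.inner x (J₁ x u) v
  ω₂_apply : ∀ x u v, ω₂ x ![u, v] = g.inner x (J₂ x u) v
  ω₃_apply : ∀ x u v, ω₃ x ![u, v] = g.inner x (J₃ x u) v
  smooth_ω₁ : ω₁.IsSmooth
  smooth_ω₂ : ω₂.IsSmooth
  smooth_ω₃ : ω₃.IsSmooth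
  closed_ω₁ : ω₁.d = 0
  closed_ω₂ : ω₂.d = 0
  closed_ω₃ : ω₃.d = 0

/-! ### Principal circle bundles and connection forms -/

section Circle

variable {EB HB EP HP : Type*} [NormedAddCommGroup EB] [NormedSpace ℝ EB] [TopologicalSpace HB]
  [NormedAddCommGroup EP] [NormedSpace ℝ EP] [TopologicalSpace HP]
  {B : Type*} [TopologicalSpace B] [ChartedSpace HB B]
  {P : Type*} [TopologicalSpace P] [ChartedSpace HP P] [MulAction Circle P]

/-- `π : P → B` is a smooth principal `S¹`-bundle: the circle acts smoothly on `P` preserving the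
fibres of `π`, and `P` is locally equivariantly diffeomorphic to `U × S¹` over `U ⊆ B`. -/
structure IsPrincipalCircleBundle (IP : ModelWithCorners ℝ EP HP) (IB : ModelWithCorners ℝ EB HB)
    (π : P → B) : Prop where
  contMDiff_smul : ContMDiff ((𝓡 1).prod IP) IP ∞ (fun q : Circle × P => q.1 • q.2)
  proj_smul : ∀ (z : Circle) (p : P), π (z • p) = π p
  exists_trivialization : ∀ b : B, ∃ (U : Set B) (e : OpenPartialHomeomorph P (B × Circle)),
    IsOpen U ∧ b ∈ U ∧ e.source = π ⁻¹' U ∧ e.target = U ×ˢ Set.univ ∧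
    ContMDiffOn IP (IB.prod (𝓡 1)) ∞ e e.source ∧
    ContMDiffOn (IB.prod (𝓡 1)) IP ∞ e.symm e.target ∧
    (∀ p ∈ e.source, (e p).1 = π p) ∧
    ∀ (z : Circle), ∀ p ∈ e.source, (e (z • p)).2 = z * (e p).2

end Circle

section Connection

variable {E : Type*} [NormedAddCommGroup E] [NormedSpace ℝ E]
  {P : Type*} [TopologicalSpace P] [ChartedSpace E P] [MulAction Circle P]

/-- The value at `p` of the generator of the circle action: the velocity at `θ = 0` of
`θ ↦ exp(iθ) • p`. -/
def circleGenerator (E : Type*) [NormedAddCommGroup E] [NormedSpace ℝ E]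
    {P : Type*} [TopologicalSpace P] [ChartedSpace E P] [MulAction Circle P] (p : P) :
    TangentSpace 𝓘(ℝ, E) p :=
  (mfderiv 𝓘(ℝ, ℝ) 𝓘(ℝ, E) (fun θ : ℝ => Circle.exp θ • p) 0 (1 : ℝ) : E)

/-- A (real valued) connection form for the circle action: a smooth invariant 1-form taking the
value 1 on the generator. -/
structure IsConnectionForm (ξ : DForm E P 1) : Prop where
  smooth : ξ.IsSmooth
  invariant : ∀ z : Circle, ξ.pullback (fun p : P => z • p) = ξ
  normalized : ∀ p : P, ξ p (fun _ => circleGenerator E p) = 1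

end Connection

/-! ### G₂ structures -/

/-- The standard coordinate 1-forms on `ℝ⁷`, numbered from 0 to 6. -/
def coordForm (i : Fin 7) : EuclideanSpace ℝ (Fin 7) [⋀^Fin 1]→L[ℝ] ℝ :=
  oneForm (EuclideanSpace.proj i)

/-- `e^i ∧ e^j ∧ e^k`. -/
def coordForm₃ (i j k : Fin 7) : EuclideanSpace ℝ (Fin 7) [⋀^Fin 3]→L[ℝ] ℝ :=
  wedge (wedge (coordForm i) (coordForm j)) (coordForm k)

/-- The standard `G₂` form on `ℝ⁷`; in the coframe `e^1, …, e^7` it is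
`e^{123} + e^{145} + e^{167} + e^{246} - e^{257} - e^{347} - e^{356}`. -/
def stdG2Form : EuclideanSpace ℝ (Fin 7) [⋀^Fin 3]→L[ℝ] ℝ :=
  coordForm₃ 0 1 2 + coordForm₃ 0 3 4 + coordForm₃ 0 5 6 + coordForm₃ 1 3 5
    - coordForm₃ 1 4 6 - coordForm₃ 2 3 6 - coordForm₃ 2 4 5

section G2

variable {V : Type*} [AddCommGroup V] [Module ℝ V] [TopologicalSpace V]

/-- A coframe (linear isomorphism to `ℝ⁷`) adapted to the 3-form `φ`, i.e. identifying `φ` with the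
standard `G₂` form. The stabiliser of the standard form is `G₂ ⊆ SO(7)`, so the inner product and
the orientation that `V` inherits from `ℝ⁷` do not depend on the choice of adapted coframe. -/
def IsAdaptedCoframe (φ : V [⋀^Fin 3]→L[ℝ] ℝ) (e : V ≃L[ℝ] EuclideanSpace ℝ (Fin 7)) : Prop :=
  φ = stdG2Form.compContinuousLinearMap (e : V →L[ℝ] EuclideanSpace ℝ (Fin 7))

/-- The frame dual to a coframe `e`. -/
def dualFrame (e : V ≃L[ℝ] EuclideanSpace ℝ (Fin 7)) (i : Fin 7) : V :=
  e.symm (EuclideanSpace.single i 1)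

/-- `ψ = *φ` for the Hodge operator of the inner product and orientation for which `b` is an
oriented orthonormal basis of the 7-dimensional space `V`. -/
def IsHodgeDual (b : Fin 7 → V) (φ : V [⋀^Fin 3]→L[ℝ] ℝ) (ψ : V [⋀^Fin 4]→L[ℝ] ℝ) : Prop :=
  ∀ σ : Equiv.Perm (Fin 7),
    ψ ![b (σ 3), b (σ 4), b (σ 5), b (σ 6)]
      = ((Equiv.Perm.sign σ : ℤ) : ℝ) * φ ![b (σ 0), b (σ 1), b (σ 2)]

end G2

section G2Manifold

variable {Y : Type*} [TopologicalSpace Y] [ChartedSpace (EuclideanSpace ℝ (Fin 7)) Y]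

/-- A `G₂` structure on a 7-manifold: a smooth 3-form that is admissible at every point. -/
structure IsG2Structure (φ : DForm (EuclideanSpace ℝ (Fin 7)) Y 3) : Prop where
  smooth : φ.IsSmooth
  admissible : ∀ y, ∃ e, IsAdaptedCoframe (φ y) e

/-- `k` is the metric determined by the `G₂` structure `φ`. -/
def IsG2Metric (φ : DForm (EuclideanSpace ℝ (Fin 7)) Y 3)
    (k : (y : Y) → TangentSpace (𝓡 7) y → TangentSpace (𝓡 7) y → ℝ) : Prop :=
  ∀ y, ∃ e : TangentSpace (𝓡 7) y ≃L[ℝ] EuclideanSpace ℝ (Fin 7),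
    IsAdaptedCoframe (φ y) e ∧ ∀ u v, k y u v = inner ℝ (e u) (e v)

/-- `ψ` is the 4-form `*φ`, for the Hodge operator of the metric and orientation determined
by the `G₂` structure `φ`. -/
def IsG2Dual (φ : DForm (EuclideanSpace ℝ (Fin 7)) Y 3)
    (ψ : DForm (EuclideanSpace ℝ (Fin 7)) Y 4) : Prop :=
  ∀ y, ∃ e : TangentSpace (𝓡 7) y ≃L[ℝ] EuclideanSpace ℝ (Fin 7),
    IsAdaptedCoframe (φ y) e ∧ IsHodgeDual (dualFrame e) (φ y) (ψ y)

/-- A torsion-free `G₂` structure: both `φ` and `*φ` are closed. -/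
structure IsTorsionFreeG2Structure (φ : DForm (EuclideanSpace ℝ (Fin 7)) Y 3) : Prop where
  isG2Structure : IsG2Structure φ
  closed : φ.d = 0
  coclosed : ∃ ψ : DForm (EuclideanSpace ℝ (Fin 7)) Y 4, IsG2Dual φ ψ ∧ ψ.IsSmooth ∧ ψ.d = 0

end G2Manifold

/-- The open half line `ℝ⁺`. -/
def posReals : TopologicalSpace.Opens ℝ := ⟨Set.Ioi 0, isOpen_Ioi⟩

end

/-!
The proof has a pointwise part and a differential part.

Pointwise, a unit vector `f₀` of a tangent space of `M` gives the `g₀`-orthonormal basis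
`f₀, J₃f₀, J₂f₀, -J₁f₀`. In the dual basis `f⁰, …, f³` one has `ω₃ = f⁰ ∧ f¹ + f² ∧ f³`,
`ω₂ = f⁰ ∧ f² - f¹ ∧ f³` and `ω₁ = -(f⁰ ∧ f³ + f¹ ∧ f²)` (`exists_quaternionic_frame`). The seven
covectors `t² dt, t⁻¹ ξ, t⁻¹ η, t f⁰, …, t f³` at a point of `Y` have no common zero, since a
connection form detects the vertical vectors of a circle bundle
(`IsPrincipalCircleBundle.eq_zero_of_mfderiv_eq_zero`), so they form a coframe
(`exists_isAnsatzCoframe`). Multiplying out, `φ` is the standard `G₂` form in this coframe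
(`IsAnsatzCoframe.form_eq`), the proposed 4-form is the sum of the complementary monomials and
hence the Hodge dual (`IsAnsatzCoframe.isHodgeDual`), and `k` is the sum of the squares of the
coframe.

Differentially, `dξ = ω₁`, `dη = -ω₂` and `dωᵢ = 0` on `Y`, and the Leibniz rule gives `dφ = 0` by
graded commutativity alone (`IsAnsatzSystem.d_ansatzForm`), while `d*φ = 0` also needs the relations
`ω₁ ∧ ω₁ = ω₂ ∧ ω₂` and `ω₃ ∧ ω₁ = ω₃ ∧ ω₂ = 0`, which hold in the coframe above
(`IsAnsatzSystem.d_ansatzDual`).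

The calculus behind this is built first. Every alternating form is the antisymmetrisation `altSum`
of some function of its arguments, the wedge product corresponds to the product of functions
(`wedge_eq_altSum`) and the exterior derivative to the derivative
(`alternatizeUncurryFin_eq_altSum`). Associativity, graded commutativity and the Leibniz rule
(`extDeriv_wedge`) thereby become statements on permutations. Through charts this passes to forms on
manifolds, together with the naturality `DForm.d_pullback` of the exterior derivative.
-/

noncomputable section

/-! ### Antisymmetrisation -/

section Antisymmetrisation

variable {V : Type*} {n k l m : ℕ}

/-- The signed sum `∑_σ sign(σ) G(v ∘ σ)` over all permutations of the arguments of an arbitrary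
function `G` of `n` variables. -/
def altSum (G : (Fin n → V) → ℝ) (v : Fin n → V) : ℝ :=
  ∑ σ : Equiv.Perm (Fin n), ((Equiv.Perm.sign σ : ℤ) : ℝ) * G (v ∘ σ)

theorem altSum_const_mul (c : ℝ) (G : (Fin n → V) → ℝ) (v : Fin n → V) :
    altSum (fun v => c * G v) v = c * altSum G v := by
  simp only [altSum, Finset.mul_sum]
  exact Finset.sum_congr rfl fun _ _ => by ring

theorem altSum_finset_sum {ι : Type*} (s : Finset ι) (G : ι → (Fin n → V) → ℝ) (v : Fin n → V) :
    altSum (fun v => ∑ i ∈ s, G i v) v = ∑ i ∈ s, altSum (G i) v := by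
  simp only [altSum, Finset.mul_sum]
  exact Finset.sum_comm

theorem sign_mul_sign_self (σ : Equiv.Perm (Fin n)) :
    ((Equiv.Perm.sign σ : ℤ) : ℝ) * ((Equiv.Perm.sign σ : ℤ) : ℝ) = 1 := by
  rcases Int.units_eq_one_or (Equiv.Perm.sign σ) with h | h <;> simp [h]

theorem sign_mul_altSum_comp (G : (Fin n → V) → ℝ) (τ : Equiv.Perm (Fin n)) (v : Fin n → V) :
    ((Equiv.Perm.sign τ : ℤ) : ℝ) * altSum (fun u => G (u ∘ τ)) v = altSum G v := by
  unfold altSum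
  rw [Finset.mul_sum]
  refine Fintype.sum_equiv (Equiv.mulRight τ) _ _ fun σ => ?_
  simp only [Equiv.coe_mulRight, Equiv.Perm.sign_mul, Units.val_mul, Int.cast_mul,
    Equiv.Perm.coe_mul, Function.comp_assoc]
  ring

theorem altSum_comp (G : (Fin n → V) → ℝ) (τ : Equiv.Perm (Fin n)) (v : Fin n → V) :
    altSum (fun u => G (u ∘ τ)) v = ((Equiv.Perm.sign τ : ℤ) : ℝ) * altSum G v := by
  rw [← sign_mul_altSum_comp G τ v, ← mul_assoc, sign_mul_sign_self, one_mul]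

/-- Antisymmetrising twice along a family of permutations only multiplies by the number of
members. -/
theorem altSum_sum_sign_comp {ι : Type*} [Fintype ι] (τ : ι → Equiv.Perm (Fin n))
    (G : (Fin n → V) → ℝ) (v : Fin n → V) :
    altSum (fun u => ∑ i, ((Equiv.Perm.sign (τ i) : ℤ) : ℝ) * G (u ∘ τ i)) v
      = Fintype.card ι * altSum G v := by
  rw [altSum_finset_sum]
  simp only [altSum_const_mul, sign_mul_altSum_comp, Finset.sum_const, Finset.card_univ,
    nsmul_eq_mul]

/-- The product of a function of the first `k` arguments with a function of the last `l`. -/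
def tensorFun (F : (Fin k → V) → ℝ) (G : (Fin l → V) → ℝ) (v : Fin (k + l) → V) : ℝ :=
  F (v ∘ Fin.castAdd l) * G (v ∘ Fin.natAdd k)

/-- Antisymmetrising first in the first `k` arguments gives each term `k!` times. -/
theorem altSum_tensorFun_altSum_left (F : (Fin k → V) → ℝ) (G : (Fin l → V) → ℝ)
    (v : Fin (k + l) → V) :
    altSum (tensorFun (altSum F) G) v = k.factorial * altSum (tensorFun F G) v := by
  have h := altSum_sum_sign_comp (fun σ : Equiv.Perm (Fin k) =>
    finSumFinEquiv.permCongr (Equiv.sumCongr σ (1 : Equiv.Perm (Fin l)))) (tensorFun F G) v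
  rw [Fintype.card_perm, Fintype.card_fin] at h
  rw [← h]
  congr 1
  funext u
  simp only [tensorFun, altSum, Finset.sum_mul]
  refine Finset.sum_congr rfl fun σ _ => ?_
  rw [Equiv.Perm.sign_permCongr]
  have hs : Equiv.Perm.sign (Equiv.sumCongr σ (1 : Equiv.Perm (Fin l))) = Equiv.Perm.sign σ := by
    simp
  rw [hs, mul_assoc]
  congr 2
  · congr 1; funext i; simp [Equiv.permCongr_apply]
  · congr 1; funext i; simp [Equiv.permCongr_apply]

theorem altSum_tensorFun_altSum_right (F : (Fin k → V) → ℝ) (G : (Fin l → V) → ℝ)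
    (v : Fin (k + l) → V) :
    altSum (tensorFun F (altSum G)) v = l.factorial * altSum (tensorFun F G) v := by
  have h := altSum_sum_sign_comp (fun σ : Equiv.Perm (Fin l) =>
    finSumFinEquiv.permCongr (Equiv.sumCongr (1 : Equiv.Perm (Fin k)) σ)) (tensorFun F G) v
  rw [Fintype.card_perm, Fintype.card_fin] at h
  rw [← h]
  congr 1
  funext u
  simp only [tensorFun, altSum, Finset.mul_sum]
  refine Finset.sum_congr rfl fun σ _ => ?_
  rw [Equiv.Perm.sign_permCongr]
  have hs : Equiv.Perm.sign (Equiv.sumCongr (1 : Equiv.Perm (Fin k)) σ) = Equiv.Perm.sign σ := by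
    simp
  rw [hs, mul_left_comm]
  congr 2
  · congr 1; funext i; simp [Equiv.permCongr_apply]
  · congr 1; funext i; simp [Equiv.permCongr_apply]

theorem altSum_cast (h : n = m) (G : (Fin m → V) → ℝ) (v : Fin n → V) :
    altSum (fun u => G (u ∘ Fin.cast h.symm)) v = altSum G (v ∘ Fin.cast h.symm) := by
  subst h; rfl

end Antisymmetrisation

/-! ### Algebra of the wedge product -/

section WedgeAlgebra

variable {V : Type*} [AddCommGroup V] [Module ℝ V] [TopologicalSpace V] {k l m : ℕ}

theorem wedge_apply_altSum (α : V [⋀^Fin k]→L[ℝ] ℝ) (β : V [⋀^Fin l]→L[ℝ] ℝ)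
    (v : Fin (k + l) → V) :
    wedge α β v = ((k.factorial : ℝ) * l.factorial)⁻¹ * altSum (tensorFun α β) v := by
  simp only [wedge, ContinuousAlternatingMap.smul_apply, smul_eq_mul,
    ContinuousMultilinearMap.alternatization_apply_apply, altSum, formTensor_apply, tensorFun]
  congr 1
  refine Finset.sum_congr rfl fun σ _ => ?_
  rw [Units.smul_def, zsmul_eq_mul]
  rfl

theorem altSum_alternating (α : V [⋀^Fin k]→L[ℝ] ℝ) (v : Fin k → V) :
    altSum α v = k.factorial * α v := by
  have h : ∀ σ : Equiv.Perm (Fin k), ((Equiv.Perm.sign σ : ℤ) : ℝ) * α (v ∘ σ) = α v := by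
    intro σ
    rw [show α (v ∘ σ) = Equiv.Perm.sign σ • α v from α.toAlternatingMap.map_perm v σ,
      Units.smul_def, zsmul_eq_mul, ← mul_assoc, sign_mul_sign_self, one_mul]
  simp only [altSum, h, Finset.sum_const, Finset.card_univ, Fintype.card_perm, Fintype.card_fin,
    nsmul_eq_mul]

theorem exists_eq_altSum (α : V [⋀^Fin k]→L[ℝ] ℝ) : ∃ F : (Fin k → V) → ℝ, ⇑α = altSum F := by
  refine ⟨fun v => (k.factorial : ℝ)⁻¹ * α v, funext fun v => ?_⟩
  have : (k.factorial : ℝ) ≠ 0 := by positivity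
  rw [altSum_const_mul, altSum_alternating]
  field_simp

/-- The wedge product of antisymmetrisations is the antisymmetrisation of the product; all the
identities between wedge products come from here. -/
theorem wedge_eq_altSum {α : V [⋀^Fin k]→L[ℝ] ℝ} {β : V [⋀^Fin l]→L[ℝ] ℝ}
    {F : (Fin k → V) → ℝ} {G : (Fin l → V) → ℝ} (hα : ⇑α = altSum F) (hβ : ⇑β = altSum G) :
    ⇑(wedge α β) = altSum (tensorFun F G) := by
  funext v
  rw [wedge_apply_altSum, hα, hβ, altSum_tensorFun_altSum_left, altSum_tensorFun_altSum_right]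
  have : (k.factorial : ℝ) ≠ 0 := by positivity
  have : (l.factorial : ℝ) ≠ 0 := by positivity
  field_simp

/-- Associativity, up to the transport between degrees `k + l + m` and `k + (l + m)`. -/
theorem wedge_assoc_apply (α : V [⋀^Fin k]→L[ℝ] ℝ) (β : V [⋀^Fin l]→L[ℝ] ℝ)
    (γ : V [⋀^Fin m]→L[ℝ] ℝ) (v : Fin (k + l + m) → V) :
    wedge (wedge α β) γ v = wedge α (wedge β γ) (v ∘ Fin.cast (Nat.add_assoc k l m).symm) := by
  obtain ⟨F, hF⟩ := exists_eq_altSum α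
  obtain ⟨G, hG⟩ := exists_eq_altSum β
  obtain ⟨H, hH⟩ := exists_eq_altSum γ
  rw [wedge_eq_altSum (wedge_eq_altSum hF hG) hH, wedge_eq_altSum hF (wedge_eq_altSum hG hH),
    ← altSum_cast]
  congr 1
  funext u
  simp only [tensorFun, mul_assoc]
  have h : (u ∘ Fin.natAdd (k + l) : Fin m → V)
      = ((u ∘ Fin.cast (Nat.add_assoc k l m).symm) ∘ Fin.natAdd k) ∘ Fin.natAdd l :=
    funext fun i => congrArg u (Fin.ext (Nat.add_assoc _ _ _))
  · rw [h]
    rfl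
  · exact Nat.add_assoc k l m

/-- Alternating forms of degrees `n = m` with the same values are the same; for numerals `n` and `m`
with `n = m` by computation this heterogeneous equality is an equality. -/
theorem heq_of_apply_cast {n m : ℕ} (h : n = m) {α : V [⋀^Fin n]→L[ℝ] ℝ}
    {β : V [⋀^Fin m]→L[ℝ] ℝ} (H : ∀ v, α v = β (v ∘ Fin.cast h.symm)) : HEq α β := by
  subst h
  exact heq_of_eq (ContinuousAlternatingMap.ext H)

theorem wedge_assoc_heq (α : V [⋀^Fin k]→L[ℝ] ℝ) (β : V [⋀^Fin l]→L[ℝ] ℝ)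
    (γ : V [⋀^Fin m]→L[ℝ] ℝ) : HEq (wedge (wedge α β) γ) (wedge α (wedge β γ)) :=
  heq_of_apply_cast (Nat.add_assoc k l m) (wedge_assoc_apply α β γ)

/-- The permutation exchanging the first `k` and the last `l` elements of `Fin (k + l)`. -/
def blockSwap (k l : ℕ) : Equiv.Perm (Fin (k + l)) :=
  finAddFlip.trans (finCongr (Nat.add_comm l k))

/-- Graded commutativity. The sign is left as the sign of a permutation, which `decide` evaluates in
each of the degrees that are needed. -/
theorem wedge_comm_apply (α : V [⋀^Fin k]→L[ℝ] ℝ) (β : V [⋀^Fin l]→L[ℝ] ℝ)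
    (v : Fin (k + l) → V) :
    wedge α β v = ((Equiv.Perm.sign (blockSwap k l) : ℤ) : ℝ)
      * wedge β α (v ∘ Fin.cast (Nat.add_comm l k)) := by
  obtain ⟨F, hF⟩ := exists_eq_altSum α
  obtain ⟨G, hG⟩ := exists_eq_altSum β
  rw [wedge_eq_altSum hF hG, wedge_eq_altSum hG hF, ← altSum_cast (Nat.add_comm k l),
    ← sign_mul_altSum_comp _ (blockSwap k l)]
  congr 2
  funext u
  simp only [tensorFun]
  rw [mul_comm]
  congr 2 <;> funext i <;> simp [blockSwap]

theorem wedge_add_left (α α' : V [⋀^Fin k]→L[ℝ] ℝ) (β : V [⋀^Fin l]→L[ℝ] ℝ) :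
    wedge (α + α') β = wedge α β + wedge α' β := by
  ext v
  simp only [wedge_apply_altSum, ContinuousAlternatingMap.add_apply, altSum, tensorFun,
    ← mul_add, ← Finset.sum_add_distrib, add_mul]

theorem wedge_add_right (α : V [⋀^Fin k]→L[ℝ] ℝ) (β β' : V [⋀^Fin l]→L[ℝ] ℝ) :
    wedge α (β + β') = wedge α β + wedge α β' := by
  ext v
  simp only [wedge_apply_altSum, ContinuousAlternatingMap.add_apply, altSum, tensorFun,
    ← mul_add, ← Finset.sum_add_distrib]

theorem wedge_smul_left (c : ℝ) (α : V [⋀^Fin k]→L[ℝ] ℝ) (β : V [⋀^Fin l]→L[ℝ] ℝ) :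
    wedge (c • α) β = c • wedge α β := by
  ext v
  rw [ContinuousAlternatingMap.smul_apply, smul_eq_mul, wedge_apply_altSum, wedge_apply_altSum,
    mul_left_comm, ← altSum_const_mul c]
  congr 2
  funext u
  simp only [tensorFun, ContinuousAlternatingMap.smul_apply, smul_eq_mul, mul_assoc]

theorem wedge_smul_right (c : ℝ) (α : V [⋀^Fin k]→L[ℝ] ℝ) (β : V [⋀^Fin l]→L[ℝ] ℝ) :
    wedge α (c • β) = c • wedge α β := by
  ext v
  rw [ContinuousAlternatingMap.smul_apply, smul_eq_mul, wedge_apply_altSum, wedge_apply_altSum,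
    mul_left_comm, ← altSum_const_mul c]
  congr 2
  funext u
  simp only [tensorFun, ContinuousAlternatingMap.smul_apply, smul_eq_mul, mul_left_comm]

theorem wedge_neg_left (α : V [⋀^Fin k]→L[ℝ] ℝ) (β : V [⋀^Fin l]→L[ℝ] ℝ) :
    wedge (-α) β = -wedge α β := by
  rw [← neg_one_smul ℝ α, wedge_smul_left]
  ext v
  simp

theorem wedge_neg_right (α : V [⋀^Fin k]→L[ℝ] ℝ) (β : V [⋀^Fin l]→L[ℝ] ℝ) :
    wedge α (-β) = -wedge α β := by
  rw [← neg_one_smul ℝ β, wedge_smul_right]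
  ext v
  simp

theorem wedge_zero_left (β : V [⋀^Fin l]→L[ℝ] ℝ) :
    wedge (0 : V [⋀^Fin k]→L[ℝ] ℝ) β = 0 := by
  rw [← zero_smul ℝ (0 : V [⋀^Fin k]→L[ℝ] ℝ), wedge_smul_left, zero_smul]

theorem wedge_zero_right (α : V [⋀^Fin k]→L[ℝ] ℝ) :
    wedge α (0 : V [⋀^Fin l]→L[ℝ] ℝ) = 0 := by
  rw [← zero_smul ℝ (0 : V [⋀^Fin l]→L[ℝ] ℝ), wedge_smul_right, zero_smul]

theorem wedge_compContinuousLinearMap {W : Type*} [AddCommGroup W] [Module ℝ W]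
    [TopologicalSpace W] (α : V [⋀^Fin k]→L[ℝ] ℝ) (β : V [⋀^Fin l]→L[ℝ] ℝ) (A : W →L[ℝ] V) :
    (wedge α β).compContinuousLinearMap A
      = wedge (α.compContinuousLinearMap A) (β.compContinuousLinearMap A) := by
  ext v
  rw [ContinuousAlternatingMap.compContinuousLinearMap_apply, wedge_apply_altSum,
    wedge_apply_altSum]
  rfl

/-! ### Wedge products in low degrees -/

-- The degrees are numerals here, so that both sides have the same type by computation and no
-- transport between `Fin (k + l)` and `Fin (l + k)` is left.

theorem wedge_one_one_comm (a b : V [⋀^Fin 1]→L[ℝ] ℝ) : wedge a b = -wedge b a := by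
  ext v
  have h : Equiv.Perm.sign (blockSwap 1 1) = -1 := by decide
  rw [wedge_comm_apply, h, ContinuousAlternatingMap.neg_apply]
  simp only [Units.val_neg, Units.val_one, Int.cast_neg, Int.cast_one, neg_mul, one_mul]
  rfl

theorem wedge_one_two_comm (a : V [⋀^Fin 1]→L[ℝ] ℝ) (w : V [⋀^Fin 2]→L[ℝ] ℝ) :
    wedge a w = wedge w a := by
  ext v
  have h : Equiv.Perm.sign (blockSwap 1 2) = 1 := by decide
  rw [wedge_comm_apply, h]
  simp only [Units.val_one, Int.cast_one, one_mul]
  rfl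

theorem wedge_two_two_comm (w w' : V [⋀^Fin 2]→L[ℝ] ℝ) : wedge w w' = wedge w' w := by
  ext v
  have h : Equiv.Perm.sign (blockSwap 2 2) = 1 := by decide
  rw [wedge_comm_apply, h]
  simp only [Units.val_one, Int.cast_one, one_mul]
  rfl

theorem wedge_wedge_one_one (a b c : V [⋀^Fin 1]→L[ℝ] ℝ) :
    wedge (wedge a b) c = wedge a (wedge b c) :=
  eq_of_heq (wedge_assoc_heq a b c)

theorem wedge_two_one_one (w : V [⋀^Fin 2]→L[ℝ] ℝ) (a b : V [⋀^Fin 1]→L[ℝ] ℝ) :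
    wedge (wedge w a) b = wedge w (wedge a b) :=
  eq_of_heq (wedge_assoc_heq w a b)

theorem wedge_two_one_one_anticomm (w : V [⋀^Fin 2]→L[ℝ] ℝ) (a b : V [⋀^Fin 1]→L[ℝ] ℝ) :
    wedge (wedge w a) b = -wedge (wedge w b) a := by
  rw [wedge_two_one_one, wedge_two_one_one, wedge_one_one_comm, wedge_neg_right]

theorem wedge_one_one_two (a b : V [⋀^Fin 1]→L[ℝ] ℝ) (w : V [⋀^Fin 2]→L[ℝ] ℝ) :
    wedge (wedge a b) w = wedge (wedge w a) b := by
  rw [wedge_two_one_one, ← wedge_two_two_comm]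

theorem wedge_two_one_two (w w' : V [⋀^Fin 2]→L[ℝ] ℝ) (a : V [⋀^Fin 1]→L[ℝ] ℝ) :
    wedge (wedge w a) w' = wedge (wedge w w') a := by
  have h₁ : wedge (wedge w a) w' = wedge w (wedge a w') :=
    eq_of_heq (wedge_assoc_heq w a w')
  have h₂ : wedge (wedge w w') a = wedge w (wedge w' a) :=
    eq_of_heq (wedge_assoc_heq w w' a)
  rw [h₁, h₂, wedge_one_two_comm]

/-- With `wedge_eq_altSum`, this makes iterated wedge products of 1-forms Leibniz expansions of
determinants. -/
theorem oneForm_eq_altSum (a : V →L[ℝ] ℝ) :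
    ⇑(oneForm a) = altSum fun v : Fin 1 → V => a (v 0) := by
  funext v
  simp [altSum, oneForm]

end WedgeAlgebra

/-! ### The Leibniz rule for the exterior derivative -/

/-- Antisymmetrising first in the last `n` arguments gives each term `n!` times. -/
theorem altSum_altSum_tail {V : Type*} {n : ℕ} (K : V → (Fin n → V) → ℝ) (v : Fin (n + 1) → V) :
    altSum (fun u => altSum (K (u 0)) (Fin.tail u)) v
      = n.factorial * altSum (fun u => K (u 0) (Fin.tail u)) v := by
  have h := altSum_sum_sign_comp (fun σ : Equiv.Perm (Fin n) =>
    Equiv.Perm.decomposeFin.symm (0, σ)) (fun u => K (u 0) (Fin.tail u)) v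
  rw [Fintype.card_perm, Fintype.card_fin] at h
  rw [← h]
  congr 1
  funext u
  simp only [altSum, Equiv.Perm.decomposeFin.symm_sign, if_true, one_mul]
  refine Finset.sum_congr rfl fun σ _ => ?_
  congr 2

theorem norm_altSum_le {E : Type*} [NormedAddCommGroup E] {n : ℕ} {G : (Fin n → E) → ℝ}
    {C : ℝ} (h : ∀ v, ‖G v‖ ≤ C * ∏ i, ‖v i‖) (v : Fin n → E) :
    ‖altSum G v‖ ≤ n.factorial * C * ∏ i, ‖v i‖ := by
  have : ∀ σ ∈ (Finset.univ : Finset (Equiv.Perm (Fin n))),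
      ‖((Equiv.Perm.sign σ : ℤ) : ℝ) * G (v ∘ σ)‖ ≤ C * ∏ i, ‖v i‖ := by
    intro σ _
    have h1 : ‖((Equiv.Perm.sign σ : ℤ) : ℝ)‖ = 1 := by
      rcases Int.units_eq_one_or (Equiv.Perm.sign σ) with h | h <;> simp [h]
    rw [norm_mul, h1, one_mul]
    refine (h _).trans_eq ?_
    rw [← Equiv.prod_comp σ fun i => ‖v i‖]
    rfl
  refine (norm_sum_le_of_le _ this).trans_eq ?_
  simp [Fintype.card_perm, mul_assoc]

section Leibniz

open ContinuousAlternatingMap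

variable {E : Type*} [NormedAddCommGroup E] [NormedSpace ℝ E] {n k l : ℕ}

/-- Mathlib's exterior derivative of a form `f` is `alternatizeUncurryFin` of the derivative of `f`.
On antisymmetrisations it is again an antisymmetrisation, so that it can be compared with the wedge
product through `wedge_eq_altSum`. -/
theorem alternatizeUncurryFin_eq_altSum {f : E →L[ℝ] E [⋀^Fin n]→L[ℝ] ℝ}
    {K : E → (Fin n → E) → ℝ} (hf : ∀ h, ⇑(f h) = altSum (K h)) :
    ⇑(alternatizeUncurryFin f) = altSum fun u => K (u 0) (Fin.tail u) := by
  funext v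
  have hn : (n.factorial : ℝ) ≠ 0 := by positivity
  have hn' : ((n + 1).factorial : ℝ) ≠ 0 := by positivity
  -- `alternatizeUncurryFin f` sums `f (v 0) (tail v)` over the cycles `(0 1 … i)`
  have h := altSum_sum_sign_comp (fun i : Fin (n + 1) => (Fin.cycleRange i).symm)
    (fun u => f (u 0) (Fin.tail u)) v
  have h₂ : (fun u : Fin (n + 1) → E => ∑ i : Fin (n + 1),
      ((Equiv.Perm.sign (Fin.cycleRange i).symm : ℤ) : ℝ) *
        f ((u ∘ (Fin.cycleRange i).symm) 0) (Fin.tail (u ∘ (Fin.cycleRange i).symm)))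
      = alternatizeUncurryFin f := by
    funext u
    rw [alternatizeUncurryFin_apply]
    refine Finset.sum_congr rfl fun i _ => ?_
    rw [Equiv.Perm.sign_symm, Fin.sign_cycleRange, zsmul_eq_mul]
    have ht : Fin.tail (u ∘ (Fin.cycleRange i).symm) = i.removeNth u := by
      funext j
      simp [Fin.tail, Fin.removeNth]
    rw [ht]
    simp
  rw [h₂, altSum_alternating, Fintype.card_fin] at h
  have h₃ : altSum (fun u => f (u 0) (Fin.tail u)) v
      = n.factorial * altSum (fun u => K (u 0) (Fin.tail u)) v := by
    rw [← altSum_altSum_tail]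
    congr 1
    funext u
    rw [hf]
  rw [h₃, Nat.factorial_succ] at h
  push_cast at h
  have hn1 : ((n : ℝ) + 1) ≠ 0 := by positivity
  apply mul_left_cancel₀ (mul_ne_zero hn1 hn)
  rw [h]
  ring

theorem alternatizeUncurryFin_wedge_left {f : E →L[ℝ] E [⋀^Fin (k + l)]→L[ℝ] ℝ}
    {A : E →L[ℝ] E [⋀^Fin k]→L[ℝ] ℝ} {β : E [⋀^Fin l]→L[ℝ] ℝ}
    (hf : ∀ h, f h = wedge (A h) β) :
    HEq (alternatizeUncurryFin f) (wedge (alternatizeUncurryFin A) β) := by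
  refine heq_of_apply_cast (Nat.add_right_comm k l 1) fun v => ?_
  choose F hF using fun h => exists_eq_altSum (A h)
  obtain ⟨G, hG⟩ := exists_eq_altSum β
  rw [alternatizeUncurryFin_eq_altSum (K := fun h => tensorFun (F h) G)
      fun h => by rw [hf, wedge_eq_altSum (hF h) hG],
    wedge_eq_altSum (alternatizeUncurryFin_eq_altSum hF) hG,
    ← altSum_cast (Nat.add_right_comm k l 1)]
  congr 1
  funext u
  simp only [tensorFun]
  congr 2
  funext i
  exact congrArg u (Fin.ext (by simp; omega))

/-- The sign is that of the cycle `(0 1 … k)`, which moves the direction of differentiation past the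
arguments of `α`. -/
theorem alternatizeUncurryFin_wedge_right {f : E →L[ℝ] E [⋀^Fin (k + l)]→L[ℝ] ℝ}
    {α : E [⋀^Fin k]→L[ℝ] ℝ} {B : E →L[ℝ] E [⋀^Fin l]→L[ℝ] ℝ}
    (hf : ∀ h, f h = wedge α (B h)) :
    alternatizeUncurryFin f = (-1 : ℝ) ^ k • wedge α (alternatizeUncurryFin B) := by
  ext v
  obtain ⟨F, hF⟩ := exists_eq_altSum α
  choose G hG using fun h => exists_eq_altSum (B h)
  have hk : k < k + l + 1 := by omega
  rw [alternatizeUncurryFin_eq_altSum (K := fun h => tensorFun F (G h))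
      fun h => by rw [hf, wedge_eq_altSum hF (hG h)], ContinuousAlternatingMap.smul_apply,
    wedge_eq_altSum hF (alternatizeUncurryFin_eq_altSum hG)]
  have h := altSum_comp (tensorFun F fun u : Fin (l + 1) → E => G (u 0) (Fin.tail u))
    (Fin.cycleRange (⟨k, hk⟩ : Fin (k + l + 1))) v
  rw [Fin.sign_cycleRange] at h
  push_cast at h
  rw [smul_eq_mul, ← h]
  congr 1
  funext u
  have h0 : Fin.cycleRange (⟨k, hk⟩ : Fin (k + l + 1)) (Fin.natAdd k (0 : Fin (l + 1))) = 0 :=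
    Fin.cycleRange_self _
  have h1 : ∀ i : Fin k, Fin.cycleRange (⟨k, hk⟩ : Fin (k + l + 1)) (Fin.castAdd (l + 1) i)
      = (Fin.castAdd l i).succ := by
    intro i
    rw [Fin.cycleRange_of_lt (Fin.lt_def.2 i.2)]
    ext
    rw [Fin.val_add_one_of_lt (Fin.lt_def.2 (by simp; omega))]
    simp
  have h2 : ∀ j : Fin l, Fin.cycleRange (⟨k, hk⟩ : Fin (k + l + 1)) (Fin.natAdd k j.succ)
      = (Fin.natAdd k j).succ := by
    intro i
    rw [Fin.cycleRange_of_gt (Fin.lt_def.2 (by simp))]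
    ext
    simp; omega
  simp only [tensorFun, Function.comp_apply, h0]
  congr 2
  · funext i
    simp only [Function.comp_apply, Fin.tail, h1]
  · funext i
    simp only [Function.comp_apply, Fin.tail, h2]

theorem alternatizeUncurryFin_smulRight (c : E →L[ℝ] ℝ) (α : E [⋀^Fin k]→L[ℝ] ℝ) :
    alternatizeUncurryFin (c.smulRight α) = (-1 : ℝ) ^ k • wedge α (oneForm c) := by
  ext v
  obtain ⟨F, hF⟩ := exists_eq_altSum α
  rw [alternatizeUncurryFin_eq_altSum (K := fun h u => c h * F u) fun h => by
      funext u
      rw [altSum_const_mul, ← hF]; rfl,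
    ContinuousAlternatingMap.smul_apply, wedge_eq_altSum hF (oneForm_eq_altSum c)]
  -- the direction of differentiation is moved to the last place
  have h := altSum_comp (tensorFun F fun u : Fin 1 → E => c (u 0)) (Fin.cycleRange (Fin.last k)) v
  rw [Fin.sign_cycleRange] at h
  push_cast at h
  refine Eq.trans ?_ h
  congr 1
  funext u
  have h1 : ∀ i : Fin k, Fin.cycleRange (Fin.last k) (Fin.castAdd 1 i) = i.succ := by
    intro i
    rw [Fin.cycleRange_of_lt (Fin.lt_def.2 i.2)]
    ext
    rw [Fin.val_add_one_of_lt (Fin.lt_def.2 (by simp))]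
    simp
  have h0 : Fin.cycleRange (Fin.last k) (Fin.natAdd k (0 : Fin 1)) = 0 :=
    Fin.cycleRange_self _
  simp only [tensorFun, Function.comp_apply, h0]
  rw [mul_comm]
  congr 2
  funext i
  simp only [Function.comp_apply, Fin.tail, h1]

/-- The wedge product as a continuous bilinear map. -/
def wedgeCLM (E : Type*) [NormedAddCommGroup E] [NormedSpace ℝ E] (k l : ℕ) :
    (E [⋀^Fin k]→L[ℝ] ℝ) →L[ℝ] (E [⋀^Fin l]→L[ℝ] ℝ) →L[ℝ] E [⋀^Fin (k + l)]→L[ℝ] ℝ :=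
  LinearMap.mkContinuous₂
    (LinearMap.mk₂ ℝ wedge wedge_add_left wedge_smul_left wedge_add_right wedge_smul_right)
    (((k.factorial : ℝ) * l.factorial)⁻¹ * (k + l).factorial) fun α β => by
      refine opNorm_le_bound _ (by positivity) fun v => ?_
      have h : ∀ u, ‖tensorFun α β u‖ ≤ ‖α‖ * ‖β‖ * ∏ i, ‖u i‖ := by
        intro u
        rw [tensorFun, norm_mul, Fin.prod_univ_add, mul_mul_mul_comm]
        exact mul_le_mul (α.le_opNorm _) (β.le_opNorm _) (norm_nonneg _) (by positivity)
      rw [LinearMap.mk₂_apply, wedge_apply_altSum, norm_mul, Real.norm_of_nonneg (by positivity)]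
      have := norm_altSum_le h v
      calc _ ≤ ((k.factorial : ℝ) * l.factorial)⁻¹ *
            ((k + l).factorial * (‖α‖ * ‖β‖) * ∏ i, ‖v i‖) := by gcongr
        _ = _ := by ring

@[simp]
theorem wedgeCLM_apply (α : E [⋀^Fin k]→L[ℝ] ℝ) (β : E [⋀^Fin l]→L[ℝ] ℝ) :
    wedgeCLM E k l α β = wedge α β := rfl

variable {F : Type*} [NormedAddCommGroup F] [NormedSpace ℝ F]

theorem ContDiffAt.wedge {r : WithTop ℕ∞} {α : F → E [⋀^Fin k]→L[ℝ] ℝ}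
    {β : F → E [⋀^Fin l]→L[ℝ] ℝ} {x : F} (hα : ContDiffAt ℝ r α x) (hβ : ContDiffAt ℝ r β x) :
    ContDiffAt ℝ r (fun x => _root_.wedge (α x) (β x)) x := by
  have h := (wedgeCLM E k l).isBoundedBilinearMap.contDiff.contDiffAt (n := r) (x := (α x, β x))
  have h' := h.comp (f := fun x => (α x, β x)) x (hα.prodMk hβ)
  simpa only [Function.comp_def, wedgeCLM_apply] using h'

/-- The Leibniz rule `d(α ∧ β) = dα ∧ β + (-1)^k α ∧ dβ`. The form `dα ∧ β` has degree
`k + 1 + l` instead of `k + l + 1`, so it is given together with its transport `γ`. -/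
theorem extDeriv_wedge {α : E → E [⋀^Fin k]→L[ℝ] ℝ} {β : E → E [⋀^Fin l]→L[ℝ] ℝ} {x : E}
    (hα : DifferentiableAt ℝ α x) (hβ : DifferentiableAt ℝ β x)
    {γ : E [⋀^Fin (k + l + 1)]→L[ℝ] ℝ} (hγ : HEq γ (wedge (extDeriv α x) (β x))) :
    extDeriv (fun x => wedge (α x) (β x)) x
      = γ + (-1 : ℝ) ^ k • wedge (α x) (extDeriv β x) := by
  have h : HasFDerivAt (fun x => wedge (α x) (β x))
      (((wedgeCLM E k l).flip (β x)).comp (fderiv ℝ α x)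
        + (wedgeCLM E k l (α x)).comp (fderiv ℝ β x)) x :=
    ((wedgeCLM E k l).hasFDerivAt_of_bilinear hα.hasFDerivAt hβ.hasFDerivAt).congr_fderiv
      (add_comm _ _)
  have h₁ : alternatizeUncurryFin (((wedgeCLM E k l).flip (β x)).comp (fderiv ℝ α x)) = γ :=
    eq_of_heq ((alternatizeUncurryFin_wedge_left fun _ => rfl).trans hγ.symm)
  have h₂ : alternatizeUncurryFin ((wedgeCLM E k l (α x)).comp (fderiv ℝ β x))
      = (-1 : ℝ) ^ k • wedge (α x) (extDeriv β x) :=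
    alternatizeUncurryFin_wedge_right fun _ => rfl
  rw [extDeriv, h.fderiv, alternatizeUncurryFin_add, h₁, h₂]

theorem extDeriv_fun_smul_form {f : E → ℝ} {α : E → E [⋀^Fin k]→L[ℝ] ℝ} {x : E}
    (hf : DifferentiableAt ℝ f x) (hα : DifferentiableAt ℝ α x) :
    extDeriv (fun x => f x • α x) x
      = f x • extDeriv α x + (-1 : ℝ) ^ k • wedge (α x) (oneForm (fderiv ℝ f x)) := by
  rw [extDeriv, fderiv_fun_smul hf hα, alternatizeUncurryFin_add,
    alternatizeUncurryFin_smulRight, alternatizeUncurryFin_smul, extDeriv]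

end Leibniz

/-! ### Calculus of differential forms on manifolds -/

section PullbackSmooth

open ContinuousAlternatingMap

variable {E F G : Type*} [NormedAddCommGroup E] [NormedSpace ℝ E]
  [NormedAddCommGroup F] [NormedSpace ℝ F] [NormedAddCommGroup G] [NormedSpace ℝ G] {k : ℕ}

/-- Antisymmetrisation as a continuous linear map. -/
def alternatizationCLM (E : Type*) [NormedAddCommGroup E] [NormedSpace ℝ E] (k : ℕ) :
    ContinuousMultilinearMap ℝ (fun _ : Fin k => E) ℝ →L[ℝ] E [⋀^Fin k]→L[ℝ] ℝ :=
  LinearMap.mkContinuous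
    { toFun := ContinuousMultilinearMap.alternatization
      map_add' := map_add _
      map_smul' := fun c f => by
        ext v
        simp only [ContinuousMultilinearMap.alternatization_apply_apply, RingHom.id_apply,
          ContinuousAlternatingMap.smul_apply, _root_.smul_apply,
          Finset.smul_sum, smul_comm c] }
    k.factorial fun f => by
      refine opNorm_le_bound _ (by positivity) fun v => ?_
      have h := norm_altSum_le (fun u => f.le_opNorm u) v
      refine le_trans (le_of_eq ?_) h
      simp only [LinearMap.coe_mk, AddHom.coe_mk, altSum,
        ContinuousMultilinearMap.alternatization_apply_apply, Units.smul_def, zsmul_eq_mul]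

/-- Pulling back forms is expressed through pulling back multilinear maps, which Mathlib knows to be
an analytic operation in both arguments. -/
theorem compContinuousLinearMap_eq_alternatizationCLM (α : F [⋀^Fin k]→L[ℝ] ℝ) (A : E →L[ℝ] F) :
    α.compContinuousLinearMap A = (k.factorial : ℝ)⁻¹ • alternatizationCLM E k
      (α.toContinuousMultilinearMap.compContinuousLinearMap fun _ => A) := by
  have hk : (k.factorial : ℝ) ≠ 0 := by positivity
  ext v
  have h : alternatizationCLM E k
      (α.toContinuousMultilinearMap.compContinuousLinearMap fun _ => A) v
      = altSum (α.compContinuousLinearMap A) v := by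
    simp only [alternatizationCLM, LinearMap.mkContinuous_apply, LinearMap.coe_mk, AddHom.coe_mk,
      altSum, ContinuousMultilinearMap.alternatization_apply_apply, Units.smul_def, zsmul_eq_mul]
    rfl
  rw [ContinuousAlternatingMap.smul_apply, h, altSum_alternating, smul_eq_mul]
  field_simp

theorem ContDiffAt.compContinuousLinearMap_form {r : WithTop ℕ∞} {β : G → F [⋀^Fin k]→L[ℝ] ℝ}
    {A : G → E →L[ℝ] F} {x : G} (hβ : ContDiffAt ℝ r β x) (hA : ContDiffAt ℝ r A x) :
    ContDiffAt ℝ r (fun y => (β y).compContinuousLinearMap (A y)) x := by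
  simp only [compContinuousLinearMap_eq_alternatizationCLM]
  refine ContDiffAt.const_smul _ ((alternatizationCLM E k).contDiff.contDiffAt.comp x ?_)
  have h := (ContinuousMultilinearMap.analyticAt_uncurry_compContinuousLinearMap (𝕜 := ℝ)
    (Fm := fun _ : Fin k => E) (Em := fun _ : Fin k => F) (G := ℝ)
    (q := (fun _ => A x, (β x).toContinuousMultilinearMap))).contDiffAt (n := r)
  exact h.comp (f := fun y => ((fun _ => A y : Fin k → E →L[ℝ] F),
    (β y).toContinuousMultilinearMap)) x ((contDiffAt_pi.2 fun _ => hA).prodMk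
      ((toContinuousMultilinearMapLI (𝕜 := ℝ)
        (E := F) (F := ℝ) (ι := Fin k)).toContinuousLinearMap.contDiff.contDiffAt.comp x hβ))

end PullbackSmooth

section FormCalculus

open Filter Topology

variable {E : Type*} [NormedAddCommGroup E] [NormedSpace ℝ E]
  {M : Type*} [TopologicalSpace M] [ChartedSpace E M]
  {F : Type*} [NormedAddCommGroup F] [NormedSpace ℝ F]
  {N : Type*} [TopologicalSpace N] [ChartedSpace F N]
  {G : Type*} [NormedAddCommGroup G] [NormedSpace ℝ G]
  {Q : Type*} [TopologicalSpace Q] [ChartedSpace G Q] {k l : ℕ}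

namespace DForm

theorem pullback_pullback_apply (f : M → N) (g : N → Q) (α : DForm G Q k) {x : M}
    (hg : MDifferentiableAt 𝓘(ℝ, F) 𝓘(ℝ, G) g (f x))
    (hf : MDifferentiableAt 𝓘(ℝ, E) 𝓘(ℝ, F) f x) :
    (α.pullback (E := F) g).pullback (E := E) f x = α.pullback (g ∘ f) x := by
  unfold DForm.pullback
  rw [mfderiv_comp x hg hf]
  rfl

theorem pullback_congr {f g : M → N} (α : DForm F N k) {x : M} (h : f =ᶠ[𝓝 x] g) :
    α.pullback (E := E) f x = α.pullback g x := by
  -- tangent spaces at different points are all `F`, so that the base point can be generalised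
  have aux : ∀ (p p' : N) (A A' : E →L[ℝ] F), p = p' → A = A' →
      (ContinuousAlternatingMap.compContinuousLinearMap (α p : F [⋀^Fin k]→L[ℝ] ℝ) A)
        = ContinuousAlternatingMap.compContinuousLinearMap (α p' : F [⋀^Fin k]→L[ℝ] ℝ) A' := by
    rintro p _ A _ rfl rfl; rfl
  exact aux _ _ _ _ h.eq_of_nhds h.mfderiv_eq

theorem inChart_eq_pullback (α : DForm E M k) (x₀ : M) :
    α.inChart x₀ = α.pullback (M := E) (extChartAt 𝓘(ℝ, E) x₀).symm := rfl

theorem IsSmooth.contDiffAt {α : DForm E M k} (hα : α.IsSmooth) (x : M) :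
    ContDiffAt ℝ ∞ (α.inChart x) (extChartAt 𝓘(ℝ, E) x x) :=
  (hα x).contDiffAt (extChartAt_target_mem_nhds x)

theorem IsSmooth.differentiableAt {α : DForm E M k} (hα : α.IsSmooth) (x : M) :
    DifferentiableAt ℝ (α.inChart x) (extChartAt 𝓘(ℝ, E) x x) :=
  (hα.contDiffAt x).differentiableAt (by simp)

theorem isSmooth_of_contDiffAt {α : DForm E M k}
    (h : ∀ x₀ : M, ∀ z ∈ (extChartAt 𝓘(ℝ, E) x₀).target, ContDiffAt ℝ ∞ (α.inChart x₀) z) :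
    α.IsSmooth := fun x₀ z hz => (h x₀ z hz).contDiffWithinAt

theorem IsSmooth.contDiffAt_of_mem {α : DForm E M k} (hα : α.IsSmooth) {x₀ : M} {z : E}
    (hz : z ∈ (extChartAt 𝓘(ℝ, E) x₀).target) : ContDiffAt ℝ ∞ (α.inChart x₀) z :=
  (hα x₀).contDiffAt ((isOpen_extChartAt_target x₀).mem_nhds hz)

section

variable [IsManifold 𝓘(ℝ, E) ∞ M]

theorem contMDiffAt_extChartAt_symm {x₀ : M} {z : E}
    (hz : z ∈ (extChartAt 𝓘(ℝ, E) x₀).target) :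
    ContMDiffAt 𝓘(ℝ, E) 𝓘(ℝ, E) ∞ (extChartAt 𝓘(ℝ, E) x₀).symm z :=
  (contMDiffOn_extChartAt_symm x₀).contMDiffAt ((isOpen_extChartAt_target x₀).mem_nhds hz)

theorem mfderiv_extChartAt_symm_self (x : M) :
    mfderiv 𝓘(ℝ, E) 𝓘(ℝ, E) (extChartAt 𝓘(ℝ, E) x).symm (extChartAt 𝓘(ℝ, E) x x)
      = ContinuousLinearMap.id ℝ E := by
  have h := mfderivWithin_range_extChartAt_symm (I := 𝓘(ℝ, E)) (x := x)
  rw [modelWithCornersSelf_coe, Set.range_id, mfderivWithin_univ] at h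
  exact h

theorem inChart_self (α : DForm E M k) (x : M) :
    α.inChart x (extChartAt 𝓘(ℝ, E) x x) = α x := by
  have aux : ∀ (p p' : M) (A : E →L[ℝ] E), p = p' → A = ContinuousLinearMap.id ℝ E →
      (ContinuousAlternatingMap.compContinuousLinearMap (α p : E [⋀^Fin k]→L[ℝ] ℝ) A)
        = (α p' : E [⋀^Fin k]→L[ℝ] ℝ) := by
    rintro p _ A rfl rfl; rfl
  exact aux _ _ _ (extChartAt_to_inv x) (mfderiv_extChartAt_symm_self x)

theorem d_apply (α : DForm E M k) (x : M) :
    α.d x = extDeriv (α.inChart x) (extChartAt 𝓘(ℝ, E) x x) := by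
  have aux : ∀ (β : E [⋀^Fin (k + 1)]→L[ℝ] ℝ) (A : E →L[ℝ] E), A = ContinuousLinearMap.id ℝ E →
      β.compContinuousLinearMap A = β := by
    rintro β _ rfl; rfl
  exact aux _ _ mfderiv_extChartAt_self

end

section Pullback

variable [IsManifold 𝓘(ℝ, E) ∞ M] [IsManifold 𝓘(ℝ, F) ∞ N]

/-- The expression of a smooth map `f` in the preferred chart at `x₀` and at a point `p` of the
target. -/
def mapInCharts (E F : Type*) [NormedAddCommGroup E] [NormedSpace ℝ E]
    {M : Type*} [TopologicalSpace M] [ChartedSpace E M] [NormedAddCommGroup F] [NormedSpace ℝ F]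
    {N : Type*} [TopologicalSpace N] [ChartedSpace F N] (f : M → N) (x₀ : M) (p : N) : E → F :=
  extChartAt 𝓘(ℝ, F) p ∘ f ∘ (extChartAt 𝓘(ℝ, E) x₀).symm

theorem contDiffAt_mapInCharts {f : M → N} (hf : ContMDiff 𝓘(ℝ, E) 𝓘(ℝ, F) ∞ f) {x₀ : M} {z : E}
    (hz : z ∈ (extChartAt 𝓘(ℝ, E) x₀).target) {p : N}
    (hp : f ((extChartAt 𝓘(ℝ, E) x₀).symm z) ∈ (chartAt F p).source) :
    ContDiffAt ℝ ∞ (mapInCharts E F f x₀ p) z :=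
  ((contMDiffAt_extChartAt' hp).comp z
    ((hf _).comp z (contMDiffAt_extChartAt_symm hz))).contDiffAt

/-- In charts, the pullback of forms by a map is the pullback on the model spaces. -/
theorem inChart_pullback_eventuallyEq {f : M → N} (hf : ContMDiff 𝓘(ℝ, E) 𝓘(ℝ, F) ∞ f)
    (α : DForm F N k) {x₀ : M} {z : E} (hz : z ∈ (extChartAt 𝓘(ℝ, E) x₀).target) {p : N}
    (hp : f ((extChartAt 𝓘(ℝ, E) x₀).symm z) ∈ (chartAt F p).source) :
    (α.pullback f).inChart x₀ =ᶠ[𝓝 z] fun z' =>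
      (α.inChart p (mapInCharts E F f x₀ p z')).compContinuousLinearMap
        (fderiv ℝ (mapInCharts E F f x₀ p) z') := by
  have hT : ∀ᶠ z' in 𝓝 z, z' ∈ (extChartAt 𝓘(ℝ, E) x₀).target :=
    (isOpen_extChartAt_target x₀).mem_nhds hz
  have hS : ∀ᶠ z' in 𝓝 z, f ((extChartAt 𝓘(ℝ, E) x₀).symm z') ∈ (chartAt F p).source :=
    (hf.continuous.continuousAt.comp (contMDiffAt_extChartAt_symm hz).continuousAt).eventually
      ((chartAt F p).open_source.mem_nhds hp)
  filter_upwards [hT, hS.eventually_nhds] with z' hz' hS'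
  have hp' := hS'.self_of_nhds
  have hψ := (contMDiffAt_extChartAt_symm hz').mdifferentiableAt (by simp)
  have hfd : MDifferentiableAt 𝓘(ℝ, E) 𝓘(ℝ, F) f ((extChartAt 𝓘(ℝ, E) x₀).symm z') :=
    (hf _).mdifferentiableAt (by simp)
  have hG := contDiffAt_mapInCharts hf hz' hp'
  have hGd : MDifferentiableAt 𝓘(ℝ, E) 𝓘(ℝ, F) (mapInCharts E F f x₀ p) z' :=
    (hG.differentiableAt (by simp)).mdifferentiableAt
  have hm : mapInCharts E F f x₀ p z' ∈ (extChartAt 𝓘(ℝ, F) p).target :=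
    (extChartAt 𝓘(ℝ, F) p).map_source (by rwa [extChartAt_source])
  have hχ : MDifferentiableAt 𝓘(ℝ, F) 𝓘(ℝ, F) (extChartAt 𝓘(ℝ, F) p).symm
      (mapInCharts E F f x₀ p z') := (contMDiffAt_extChartAt_symm hm).mdifferentiableAt (by simp)
  have hcongr : (f ∘ (extChartAt 𝓘(ℝ, E) x₀).symm) =ᶠ[𝓝 z']
      ((extChartAt 𝓘(ℝ, F) p).symm ∘ mapInCharts E F f x₀ p) := by
    filter_upwards [hS'] with u hu
    exact ((extChartAt 𝓘(ℝ, F) p).left_inv (by rwa [extChartAt_source])).symm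
  rw [inChart_eq_pullback, pullback_pullback_apply _ _ _ hfd hψ, pullback_congr α hcongr,
    ← pullback_pullback_apply _ _ _ hχ hGd, ← inChart_eq_pullback, ← mfderiv_eq_fderiv]
  rfl

theorem IsSmooth.pullback {f : M → N} {α : DForm F N k} (hα : α.IsSmooth)
    (hf : ContMDiff 𝓘(ℝ, E) 𝓘(ℝ, F) ∞ f) : (α.pullback (E := E) f).IsSmooth := by
  refine isSmooth_of_contDiffAt fun x₀ z hz => ?_
  have hp := mem_chart_source F (f ((extChartAt 𝓘(ℝ, E) x₀).symm z))
  have hG := contDiffAt_mapInCharts hf hz hp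
  refine ContDiffAt.congr_of_eventuallyEq ?_ (inChart_pullback_eventuallyEq hf α hz hp)
  have h := ContDiffAt.comp (g := α.inChart (f ((extChartAt 𝓘(ℝ, E) x₀).symm z))) z
    (hα.contDiffAt _) hG
  exact ContDiffAt.compContinuousLinearMap_form h (hG.fderiv_right (by simp))

theorem d_pullback {f : M → N} {α : DForm F N k} (hα : α.IsSmooth)
    (hf : ContMDiff 𝓘(ℝ, E) 𝓘(ℝ, F) ∞ f) : (α.pullback (E := E) f).d = α.d.pullback f := by
  funext x
  have hz := mem_extChartAt_target (I := 𝓘(ℝ, E)) x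
  have hx : (extChartAt 𝓘(ℝ, E) x).symm (extChartAt 𝓘(ℝ, E) x x) = x := extChartAt_to_inv x
  have hp : f ((extChartAt 𝓘(ℝ, E) x).symm (extChartAt 𝓘(ℝ, E) x x))
      ∈ (chartAt F (f x)).source := by rw [hx]; exact mem_chart_source F (f x)
  have hG := contDiffAt_mapInCharts hf hz hp
  have hGx : mapInCharts E F f x (f x) (extChartAt 𝓘(ℝ, E) x x)
      = extChartAt 𝓘(ℝ, F) (f x) (f x) := by
    simp only [mapInCharts, Function.comp_apply, hx]
  rw [d_apply, (inChart_pullback_eventuallyEq hf α hz hp).extDeriv_eq,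
    extDeriv_pullback (r := ∞) (by rw [hGx]; exact hα.differentiableAt _) hG
      (by
        rw [minSmoothness_of_isRCLikeNormedField]
        exact WithTop.coe_le_coe.2 le_top), hGx, ← d_apply]
  have hd : fderiv ℝ (mapInCharts E F f x (f x)) (extChartAt 𝓘(ℝ, E) x x)
      = mfderiv 𝓘(ℝ, E) 𝓘(ℝ, F) f x := by
    rw [((hf x).mdifferentiableAt (by simp)).mfderiv, modelWithCornersSelf_coe, Set.range_id,
      fderivWithin_univ]
    rfl
  rw [hd]
  rfl

end Pullback

section Operations

variable {α β : DForm E M k} {γ : DForm E M l} {f : M → ℝ}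

theorem inChart_wedge (α : DForm E M k) (γ : DForm E M l) (x₀ : M) :
    DForm.inChart (E := E) (fun y => wedge (α y) (γ y)) x₀
      = fun z => wedge (α.inChart x₀ z) (γ.inChart x₀ z) := by
  funext z
  exact wedge_compContinuousLinearMap _ _ _

theorem IsSmooth.wedge (hα : α.IsSmooth) (hγ : γ.IsSmooth) :
    DForm.IsSmooth (E := E) (fun y => _root_.wedge (α y) (γ y)) := by
  refine isSmooth_of_contDiffAt fun x₀ z hz => ?_
  rw [inChart_wedge]
  exact (hα.contDiffAt_of_mem hz).wedge (hγ.contDiffAt_of_mem hz)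

theorem IsSmooth.add (hα : α.IsSmooth) (hβ : β.IsSmooth) : (α + β).IsSmooth :=
  isSmooth_of_contDiffAt fun _ _ hz => (hα.contDiffAt_of_mem hz).add (hβ.contDiffAt_of_mem hz)

theorem IsSmooth.sub (hα : α.IsSmooth) (hβ : β.IsSmooth) : (α - β).IsSmooth :=
  isSmooth_of_contDiffAt fun _ _ hz => (hα.contDiffAt_of_mem hz).sub (hβ.contDiffAt_of_mem hz)

theorem fderiv_comp_extChartAt_symm (hf : ContMDiff 𝓘(ℝ, E) 𝓘(ℝ, ℝ) ∞ f) (x : M) :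
    fderiv ℝ (fun z => f ((extChartAt 𝓘(ℝ, E) x).symm z)) (extChartAt 𝓘(ℝ, E) x x)
      = mfderiv 𝓘(ℝ, E) 𝓘(ℝ, ℝ) f x := by
  rw [((hf x).mdifferentiableAt (by simp)).mfderiv, modelWithCornersSelf_coe, Set.range_id,
    fderivWithin_univ]
  rfl

/-- The differential of `f` is the pullback by `f` of the coordinate form of the real line; so its
smoothness and closedness follow from those of the coordinate form. -/
theorem ofFun_eq_pullback (f : M → ℝ) :
    DForm.ofFun (E := E) f
      = DForm.pullback (E := E) f (fun _ : ℝ => oneForm (ContinuousLinearMap.id ℝ ℝ)) := by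
  funext x
  ext v
  rfl

variable [IsManifold 𝓘(ℝ, E) ∞ M]

theorem d_add (hα : α.IsSmooth) (hβ : β.IsSmooth) : (α + β).d = α.d + β.d := by
  funext x
  rw [Pi.add_apply, d_apply, d_apply, d_apply]
  exact extDeriv_fun_add (hα.differentiableAt x) (hβ.differentiableAt x)

theorem d_sub (hα : α.IsSmooth) (hβ : β.IsSmooth) : (α - β).d = α.d - β.d := by
  funext x
  rw [Pi.sub_apply, d_apply, d_apply, d_apply]
  have h := fderiv_fun_sub (hα.differentiableAt x) (hβ.differentiableAt x)
  have h' := map_sub (ContinuousAlternatingMap.alternatizeUncurryFinCLM ℝ E ℝ (n := k))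
    (fderiv ℝ (α.inChart x) (extChartAt 𝓘(ℝ, E) x x))
    (fderiv ℝ (β.inChart x) (extChartAt 𝓘(ℝ, E) x x))
  rw [← h] at h'
  exact h'

theorem contDiffAt_comp_extChartAt_symm (hf : ContMDiff 𝓘(ℝ, E) 𝓘(ℝ, ℝ) ∞ f) {x₀ : M} {z : E}
    (hz : z ∈ (extChartAt 𝓘(ℝ, E) x₀).target) :
    ContDiffAt ℝ ∞ (fun z => f ((extChartAt 𝓘(ℝ, E) x₀).symm z)) z :=
  ((hf _).comp z (contMDiffAt_extChartAt_symm hz)).contDiffAt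

theorem IsSmooth.smul (hf : ContMDiff 𝓘(ℝ, E) 𝓘(ℝ, ℝ) ∞ f) (hα : α.IsSmooth) :
    DForm.IsSmooth (E := E) (fun y => f y • α y) :=
  isSmooth_of_contDiffAt fun _ _ hz =>
    (contDiffAt_comp_extChartAt_symm hf hz).smul (hα.contDiffAt_of_mem hz)

/-- The Leibniz rule on a manifold; `δ` is `dα ∧ γ` transported to degree `k + l + 1`. -/
theorem d_wedge_apply (hα : α.IsSmooth) (hγ : γ.IsSmooth) (x : M)
    {δ : TangentSpace 𝓘(ℝ, E) x [⋀^Fin (k + l + 1)]→L[ℝ] ℝ} (hδ : HEq δ (wedge (α.d x) (γ x))) :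
    DForm.d (E := E) (fun y => wedge (α y) (γ y)) x
      = δ + (-1 : ℝ) ^ k • wedge (α x) (γ.d x) := by
  rw [d_apply, d_apply, inChart_wedge]
  rw [d_apply] at hδ
  have h := extDeriv_wedge (hα.differentiableAt x) (hγ.differentiableAt x) (γ := δ)
    (by rw [inChart_self]; exact hδ)
  rw [inChart_self] at h
  exact h

theorem d_smul_apply (hf : ContMDiff 𝓘(ℝ, E) 𝓘(ℝ, ℝ) ∞ f) (hα : α.IsSmooth) (x : M) :
    DForm.d (E := E) (fun y => f y • α y) x
      = f x • α.d x + (-1 : ℝ) ^ k • wedge (α x) (DForm.ofFun (E := E) f x) := by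
  have hz := mem_extChartAt_target (I := 𝓘(ℝ, E)) x
  rw [d_apply, d_apply]
  have h := extDeriv_fun_smul_form
    ((contDiffAt_comp_extChartAt_symm hf hz).differentiableAt (by simp)) (hα.differentiableAt x)
  rw [inChart_self, fderiv_comp_extChartAt_symm hf, extChartAt_to_inv] at h
  exact h

theorem inChart_coord (s : ℝ) :
    DForm.inChart (E := ℝ) (fun _ : ℝ => oneForm (ContinuousLinearMap.id ℝ ℝ)) s
      = fun _ => oneForm (ContinuousLinearMap.id ℝ ℝ) := by
  funext z
  have : mfderiv 𝓘(ℝ, ℝ) 𝓘(ℝ, ℝ) (extChartAt 𝓘(ℝ, ℝ) s).symm z = ContinuousLinearMap.id ℝ ℝ := by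
    rw [extChartAt_model_space_eq_id]
    exact mfderiv_id
  unfold DForm.inChart
  rw [this]
  rfl

theorem isSmooth_coord :
    DForm.IsSmooth (E := ℝ) (fun _ : ℝ => oneForm (ContinuousLinearMap.id ℝ ℝ)) := by
  intro s
  rw [inChart_coord]
  exact contDiffOn_const

theorem d_coord :
    DForm.d (E := ℝ) (fun _ : ℝ => oneForm (ContinuousLinearMap.id ℝ ℝ)) = 0 := by
  funext s
  rw [d_apply, inChart_coord, extDeriv, fderiv_fun_const]
  exact map_zero (ContinuousAlternatingMap.alternatizeUncurryFinCLM ℝ ℝ ℝ)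

theorem isSmooth_ofFun (hf : ContMDiff 𝓘(ℝ, E) 𝓘(ℝ, ℝ) ∞ f) :
    (DForm.ofFun (E := E) f).IsSmooth := by
  rw [ofFun_eq_pullback]
  exact isSmooth_coord.pullback hf

theorem d_ofFun (hf : ContMDiff 𝓘(ℝ, E) 𝓘(ℝ, ℝ) ∞ f) : (DForm.ofFun (E := E) f).d = 0 := by
  rw [ofFun_eq_pullback, d_pullback isSmooth_coord hf, d_coord]
  funext x
  ext v
  rfl

end Operations

end DForm

end FormCalculus

/-! ### Principal circle bundles -/

section CircleBundle

open Filter Topology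

variable {E EB HB : Type*} [NormedAddCommGroup E] [NormedSpace ℝ E]
  [NormedAddCommGroup EB] [NormedSpace ℝ EB] [TopologicalSpace HB]
  {B : Type*} [TopologicalSpace B] [ChartedSpace HB B]
  {P : Type*} [TopologicalSpace P] [ChartedSpace E P] [MulAction Circle P]
  {IB : ModelWithCorners ℝ EB HB} {π : P → B}

theorem IsPrincipalCircleBundle.contMDiff (hπ : IsPrincipalCircleBundle 𝓘(ℝ, E) IB π) :
    ContMDiff 𝓘(ℝ, E) IB ∞ π := by
  intro p
  obtain ⟨U, e, hU, hb, hs, -, he, -, hfst, -⟩ := hπ.exists_trivialization (π p)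
  have hp : p ∈ e.source := by rw [hs]; exact hb
  have h : ContMDiffAt 𝓘(ℝ, E) IB ∞ (fun q => (e q).1) p :=
    contMDiffAt_fst.comp p ((he p hp).contMDiffAt (e.open_source.mem_nhds hp))
  refine h.congr_of_eventuallyEq ?_
  filter_upwards [e.open_source.mem_nhds hp] with q hq using (hfst q hq).symm

theorem form_one_apply_smul {V : Type*} [AddCommGroup V] [Module ℝ V] [TopologicalSpace V]
    (α : V [⋀^Fin 1]→L[ℝ] ℝ) (c : ℝ) (u : V) : α (fun _ => c • u) = c * α (fun _ => u) := by
  have h := α.toMultilinearMap.map_smul_univ (fun _ => c) (fun _ => u)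
  simpa using! h

theorem IsConnectionForm.circleGenerator_ne_zero {ξ : DForm E P 1} (hξ : IsConnectionForm ξ)
    (p : P) : (circleGenerator E p : E) ≠ 0 := by
  intro h
  let α : E [⋀^Fin 1]→L[ℝ] ℝ := ξ p
  have h1 : α (fun _ => (circleGenerator E p : E)) = 1 := hξ.normalized p
  have h0 := form_one_apply_smul α 0 0
  rw [h] at h1
  rw [smul_zero, zero_mul] at h0
  exact zero_ne_one (h0.symm.trans h1)

/-- The generator is vertical, since the projection is constant on the orbits. -/
theorem IsPrincipalCircleBundle.mfderiv_circleGenerator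
    (hπ : IsPrincipalCircleBundle 𝓘(ℝ, E) IB π) {ξ : DForm E P 1} (hξ : IsConnectionForm ξ)
    (p : P) : mfderiv 𝓘(ℝ, E) IB π p (circleGenerator E p) = 0 := by
  have h0 : Circle.exp 0 • p = p := by simp
  have hd : MDifferentiableAt 𝓘(ℝ, ℝ) 𝓘(ℝ, E) (fun θ : ℝ => Circle.exp θ • p) 0 := by
    -- otherwise the derivative defining the generator is zero by convention, and the connection form
    -- could not take the value 1 on it
    by_contra h
    apply hξ.circleGenerator_ne_zero p
    unfold circleGenerator
    rw [mfderiv_zero_of_not_mdifferentiableAt h]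
    rfl
  have hπd : MDifferentiableAt 𝓘(ℝ, E) IB π (Circle.exp 0 • p) :=
    (hπ.contMDiff _).mdifferentiableAt (by simp)
  have hc := mfderiv_comp (0 : ℝ) hπd hd
  have hconst : π ∘ (fun θ : ℝ => Circle.exp θ • p) = fun _ => π p :=
    funext fun θ => hπ.proj_smul _ p
  rw [hconst, mfderiv_const] at hc
  -- the two base points `1 • p` and `p` agree only propositionally
  have aux : ∀ p' : P, p' = p → ∀ X : E, mfderiv 𝓘(ℝ, E) IB π p' X = (0 : EB) →
      mfderiv 𝓘(ℝ, E) IB π p X = (0 : EB) := by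
    rintro p' rfl X h; exact h
  exact aux _ h0 _ (DFunLike.congr_fun hc (1 : ℝ)).symm

/-- A vertical vector is a multiple of the generator of the action, because the fibres are
one-dimensional; so it vanishes if a connection form vanishes on it. -/
theorem IsPrincipalCircleBundle.eq_zero_of_mfderiv_eq_zero
    (hπ : IsPrincipalCircleBundle 𝓘(ℝ, E) IB π) {ξ : DForm E P 1} (hξ : IsConnectionForm ξ)
    {p : P} {u : E} (hu : mfderiv 𝓘(ℝ, E) IB π p u = (0 : EB))
    (hu' : ξ p (fun _ => u) = 0) : u = 0 := by
  obtain ⟨U, e, hU, hb, hs, ht, he, he', hfst, -⟩ := hπ.exists_trivialization (π p)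
  have hp : p ∈ e.source := by rw [hs]; exact hb
  have hed : MDifferentiableAt 𝓘(ℝ, E) (IB.prod (𝓡 1)) e p :=
    ((he p hp).contMDiffAt (e.open_source.mem_nhds hp)).mdifferentiableAt (by simp)
  have hed' : MDifferentiableAt (IB.prod (𝓡 1)) 𝓘(ℝ, E) e.symm (e p) :=
    ((he' _ (e.map_source hp)).contMDiffAt
      (e.open_target.mem_nhds (e.map_source hp))).mdifferentiableAt (by simp)
  set D : E →L[ℝ] EB × EuclideanSpace ℝ (Fin 1) :=
    mfderiv 𝓘(ℝ, E) (IB.prod (𝓡 1)) e p with hD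
  have hinj : ∀ w : E, D w = 0 → w = 0 := by
    intro w hw
    have h1 := mfderiv_comp p hed' hed
    have h2 : e.symm ∘ e =ᶠ[𝓝 p] id := by
      filter_upwards [e.open_source.mem_nhds hp] with q hq using e.left_inv hq
    have h3 : (mfderiv 𝓘(ℝ, E) 𝓘(ℝ, E) (e.symm ∘ e) p : E →L[ℝ] E)
        = ContinuousLinearMap.id ℝ E := h2.mfderiv_eq.trans mfderiv_id
    let D' : EB × EuclideanSpace ℝ (Fin 1) →L[ℝ] E :=
      mfderiv (IB.prod (𝓡 1)) 𝓘(ℝ, E) e.symm (e p)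
    have h4 : w = D' (D w) := DFunLike.congr_fun (h3.symm.trans h1) w
    rw [h4, hw, map_zero]
  have hfst' : ∀ w : E, (D w).1 = (mfderiv 𝓘(ℝ, E) IB π p w : EB) := by
    intro w
    have h1 := mfderiv_comp (I'' := IB) p (mdifferentiableAt_fst (x := e p)) hed
    have h2 : Prod.fst ∘ e =ᶠ[𝓝 p] π := by
      filter_upwards [e.open_source.mem_nhds hp] with q hq using hfst q hq
    have h3 : (mfderiv 𝓘(ℝ, E) IB (Prod.fst ∘ e) p : E →L[ℝ] EB)
        = mfderiv 𝓘(ℝ, E) IB π p := h2.mfderiv_eq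
    rw [mfderiv_fst] at h1
    exact (DFunLike.congr_fun (h3.symm.trans h1) w).symm
  -- the vertical vectors are those with `(D w).1 = 0`; for them only one coordinate is left
  set X : E := circleGenerator E p with hX
  have hX1 : (D X).1 = 0 := (hfst' X).trans (hπ.mfderiv_circleGenerator hξ p)
  have hX2 : (D X).2 ≠ 0 := fun h =>
    hξ.circleGenerator_ne_zero p (hinj X (Prod.ext hX1 h))
  have hX20 : (D X).2 0 ≠ 0 := fun h => hX2 (by ext i; fin_cases i; exact h)
  set c : ℝ := (D u).2 0 / (D X).2 0 with hc
  have huX : u = c • X := by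
    rw [← sub_eq_zero]
    apply hinj
    rw [map_sub, map_smul]
    refine Prod.ext ?_ ?_
    · rw [Prod.fst_sub, Prod.smul_fst, hX1, hfst' u, hu, smul_zero, sub_zero]; rfl
    · ext i
      fin_cases i
      simp [hc, hX20]
  let α : E [⋀^Fin 1]→L[ℝ] ℝ := ξ p
  have h1 := form_one_apply_smul α c X
  rw [← huX] at h1
  have h2 : α (fun _ => X) = 1 := hξ.normalized p
  have h3 : c = 0 := by
    rw [h2, mul_one] at h1
    exact h1.symm.trans hu'
  rw [huX, h3, zero_smul]

end CircleBundle

section PosReals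

open Filter Topology

/-- The charts of an open subset of `ℝ` are restrictions of the identity. -/
theorem mfderiv_posReals_val (s : posReals) :
    (mfderiv 𝓘(ℝ, ℝ) 𝓘(ℝ, ℝ) (Subtype.val : posReals → ℝ) s : ℝ →L[ℝ] ℝ)
      = ContinuousLinearMap.id ℝ ℝ := by
  have hd : MDifferentiableAt 𝓘(ℝ, ℝ) 𝓘(ℝ, ℝ) (Subtype.val : posReals → ℝ) s :=
    (contMDiff_subtype_val (n := ∞) s).mdifferentiableAt (by simp)
  rw [hd.mfderiv, modelWithCornersSelf_coe, Set.range_id, fderivWithin_univ]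
  have h : writtenInExtChartAt 𝓘(ℝ, ℝ) 𝓘(ℝ, ℝ) s (Subtype.val : posReals → ℝ)
      =ᶠ[𝓝 (extChartAt 𝓘(ℝ, ℝ) s s)] id := by
    filter_upwards [extChartAt_target_mem_nhds (I := 𝓘(ℝ, ℝ)) s] with z hz
    exact (extChartAt 𝓘(ℝ, ℝ) s).right_inv hz
  rw [h.fderiv_eq, fderiv_id]

end PosReals

/-! ### Linear algebra of the `G₂` form -/

section Monomials

variable {V : Type*} [AddCommGroup V] [Module ℝ V] [TopologicalSpace V]

theorem wedge_one_one_self (a : V [⋀^Fin 1]→L[ℝ] ℝ) : wedge a a = 0 := by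
  have h := wedge_one_one_comm a a
  ext v
  have h' := DFunLike.congr_fun h v
  rw [ContinuousAlternatingMap.neg_apply] at h'
  change wedge a a v = 0
  linarith

theorem wedge_two_one_one_self (w : V [⋀^Fin 2]→L[ℝ] ℝ) (a : V [⋀^Fin 1]→L[ℝ] ℝ) :
    wedge (wedge w a) a = 0 := by
  rw [wedge_two_one_one, wedge_one_one_self, wedge_zero_right]

theorem wedge_two_one_one_one_self (w : V [⋀^Fin 2]→L[ℝ] ℝ) (a b : V [⋀^Fin 1]→L[ℝ] ℝ) :
    wedge (wedge (wedge w a) b) a = 0 := by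
  have h : wedge (wedge (wedge w b) a) a = wedge (wedge w b) (wedge a a) :=
    eq_of_heq (wedge_assoc_heq (wedge w b) a a)
  rw [wedge_two_one_one_anticomm, wedge_neg_left, h, wedge_one_one_self, wedge_zero_right]
  exact neg_zero

theorem wedge_one_one_one_rotate (a b c : V [⋀^Fin 1]→L[ℝ] ℝ) :
    wedge (wedge a b) c = wedge (wedge c a) b := by
  rw [wedge_wedge_one_one c a b, wedge_one_two_comm]

theorem wedge_one_one_one_swap (a b c : V [⋀^Fin 1]→L[ℝ] ℝ) :
    wedge (wedge a b) c = -wedge (wedge a c) b := by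
  rw [wedge_wedge_one_one, wedge_one_one_comm b c, wedge_neg_right, wedge_wedge_one_one]

/-- Move the last two factors to the front. -/
theorem wedge_four_rotate (a b c d : V [⋀^Fin 1]→L[ℝ] ℝ) :
    wedge (wedge (wedge a b) c) d = wedge (wedge (wedge c d) a) b := by
  rw [wedge_two_one_one, wedge_two_one_one, wedge_two_two_comm]

theorem wedge_two_two_eq (a b c d : V [⋀^Fin 1]→L[ℝ] ℝ) :
    wedge (wedge a b) (wedge c d) = wedge (wedge (wedge a b) c) d :=
  (wedge_two_one_one _ _ _).symm

theorem wedge_two_two_zero₁ (a b d : V [⋀^Fin 1]→L[ℝ] ℝ) :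
    wedge (wedge a b) (wedge b d) = 0 := by
  rw [wedge_two_two_eq, wedge_wedge_one_one a b b, wedge_one_one_self, wedge_zero_right,
    wedge_zero_left]

theorem wedge_two_two_zero₂ (a b d : V [⋀^Fin 1]→L[ℝ] ℝ) :
    wedge (wedge a b) (wedge a d) = 0 := by
  rw [wedge_one_one_comm a b, wedge_neg_left, wedge_two_two_zero₁, neg_zero]

theorem wedge_two_two_zero₃ (a b c : V [⋀^Fin 1]→L[ℝ] ℝ) :
    wedge (wedge a b) (wedge c b) = 0 := by
  rw [wedge_one_one_comm c b, wedge_neg_right, wedge_two_two_zero₁, neg_zero]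

theorem wedge_two_two_zero₄ (a b c : V [⋀^Fin 1]→L[ℝ] ℝ) :
    wedge (wedge a b) (wedge c a) = 0 := by
  rw [wedge_one_one_comm c a, wedge_neg_right, wedge_two_two_zero₂, neg_zero]

theorem wedge_oneForm₂_apply (a b : V →L[ℝ] ℝ) (v : Fin 2 → V) :
    wedge (oneForm a) (oneForm b) v = a (v 0) * b (v 1) - a (v 1) * b (v 0) := by
  rw [wedge_eq_altSum (oneForm_eq_altSum a) (oneForm_eq_altSum b)]
  have h := Matrix.det_fin_two (Matrix.of fun i j => (![a, b] j : V →L[ℝ] ℝ) (v i))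
  rw [Matrix.det_apply'] at h
  simp only [Fin.prod_univ_two, Matrix.of_apply, Matrix.cons_val_zero, Matrix.cons_val_one] at h
  refine Eq.trans ?_ (h.trans (by ring))
  rfl

/-- The wedge product of three 1-forms is a determinant. -/
theorem wedge_oneForm₃_apply (a : Fin 3 → V →L[ℝ] ℝ) (v : Fin 3 → V) :
    wedge (wedge (oneForm (a 0)) (oneForm (a 1))) (oneForm (a 2)) v
      = (Matrix.of fun i j => a j (v i)).det := by
  rw [wedge_eq_altSum (wedge_eq_altSum (oneForm_eq_altSum _) (oneForm_eq_altSum _))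
    (oneForm_eq_altSum _), Matrix.det_apply']
  simp only [Fin.prod_univ_three]
  rfl

/-- The wedge product of four 1-forms is a determinant. -/
theorem wedge_oneForm₄_apply (a : Fin 4 → V →L[ℝ] ℝ) (v : Fin 4 → V) :
    wedge (wedge (wedge (oneForm (a 0)) (oneForm (a 1))) (oneForm (a 2))) (oneForm (a 3)) v
      = (Matrix.of fun i j => a j (v i)).det := by
  rw [wedge_eq_altSum (wedge_eq_altSum (wedge_eq_altSum (oneForm_eq_altSum _)
    (oneForm_eq_altSum _)) (oneForm_eq_altSum _)) (oneForm_eq_altSum _), Matrix.det_apply']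
  simp only [Fin.prod_univ_four]
  rfl

end Monomials

section Hodge

/-- Complementary minors of an orthogonal matrix agree up to its determinant. -/
theorem Matrix.det_fromBlocks_orthogonal {m n : Type*} [Fintype m] [Fintype n] [DecidableEq m]
    [DecidableEq n] (A : Matrix m m ℝ) (B : Matrix m n ℝ) (C : Matrix n m ℝ) (D : Matrix n n ℝ)
    (h : Matrix.fromBlocks A B C D * (Matrix.fromBlocks A B C D).transpose = 1) :
    D.det = (Matrix.fromBlocks A B C D).det * A.det := by
  rw [Matrix.fromBlocks_transpose, Matrix.fromBlocks_multiply, ← Matrix.fromBlocks_one,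
    Matrix.fromBlocks_inj] at h
  obtain ⟨h₁, -, h₃, -⟩ := h
  have key : Matrix.fromBlocks A B C D * Matrix.fromBlocks A.transpose 0 B.transpose 1
      = Matrix.fromBlocks 1 B 0 D := by
    rw [Matrix.fromBlocks_multiply, h₁, h₃]
    simp
  have hdet := congrArg Matrix.det key
  rw [Matrix.det_mul, Matrix.det_fromBlocks_zero₁₂, Matrix.det_fromBlocks_zero₂₁] at hdet
  simpa using hdet.symm

/-- Complementary minors of a permutation matrix. -/
theorem det_perm_lower_minor (ρ : Equiv.Perm (Fin 7)) :
    (Matrix.of fun i j : Fin 4 => if ρ (Fin.natAdd 3 i) = Fin.natAdd 3 j then (1 : ℝ) else 0).det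
      = ((Equiv.Perm.sign ρ : ℤ) : ℝ) *
        (Matrix.of fun i j : Fin 3 =>
          if ρ (Fin.castAdd 4 i) = Fin.castAdd 4 j then (1 : ℝ) else 0).det := by
  set ρ' : Equiv.Perm (Fin 3 ⊕ Fin 4) := (finSumFinEquiv (m := 3) (n := 4)).symm.permCongr ρ
    with hρ'
  have hs : Equiv.Perm.sign ρ' = Equiv.Perm.sign ρ := Equiv.Perm.sign_permCongr _ _
  have hblocks := Matrix.fromBlocks_toBlocks (ρ'.permMatrix ℝ)
  have horth : ρ'.permMatrix ℝ * (ρ'.permMatrix ℝ).transpose = 1 := by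
    rw [PEquiv.toMatrix_toPEquiv_mul]
    ext i j
    simp [PEquiv.toMatrix_apply, Matrix.one_apply]
  rw [← hblocks] at horth
  have h := Matrix.det_fromBlocks_orthogonal _ _ _ _ horth
  rw [hblocks, Matrix.det_permutation, hs] at h
  convert h using 2
  · ext i j
    simp [Matrix.toBlocks₂₂, PEquiv.toMatrix_apply, hρ', Equiv.permCongr_apply,
      Equiv.symm_apply_eq]
    rfl
  · congr 1
    ext i j
    simp [Matrix.toBlocks₁₁, PEquiv.toMatrix_apply, hρ', Equiv.permCongr_apply,
      Equiv.symm_apply_eq]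
    rfl

variable {V : Type*} [AddCommGroup V] [Module ℝ V] [TopologicalSpace V]

theorem IsHodgeDual.add {b : Fin 7 → V} {φ φ' : V [⋀^Fin 3]→L[ℝ] ℝ} {ψ ψ' : V [⋀^Fin 4]→L[ℝ] ℝ}
    (h : IsHodgeDual b φ ψ) (h' : IsHodgeDual b φ' ψ') : IsHodgeDual b (φ + φ') (ψ + ψ') := by
  intro σ
  simp only [ContinuousAlternatingMap.add_apply, h σ, h' σ, mul_add]

theorem IsHodgeDual.sub {b : Fin 7 → V} {φ φ' : V [⋀^Fin 3]→L[ℝ] ℝ} {ψ ψ' : V [⋀^Fin 4]→L[ℝ] ℝ}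
    (h : IsHodgeDual b φ ψ) (h' : IsHodgeDual b φ' ψ') : IsHodgeDual b (φ - φ') (ψ - ψ') := by
  intro σ
  simp only [ContinuousAlternatingMap.sub_apply, h σ, h' σ, mul_sub]

/-- For an even permutation `τ`, the Hodge dual of `e^{τ0 τ1 τ2}` is `e^{τ3 τ4 τ5 τ6}`. -/
theorem isHodgeDual_monomial {a : Fin 7 → V →L[ℝ] ℝ} {b : Fin 7 → V}
    (hab : ∀ i j, a i (b j) = if i = j then 1 else 0) (τ : Equiv.Perm (Fin 7))
    (hτ : Equiv.Perm.sign τ = 1) :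
    IsHodgeDual b
      (wedge (wedge (oneForm (a (τ 0))) (oneForm (a (τ 1)))) (oneForm (a (τ 2))))
      (wedge (wedge (wedge (oneForm (a (τ 3))) (oneForm (a (τ 4)))) (oneForm (a (τ 5))))
        (oneForm (a (τ 6)))) := by
  intro σ
  have h₃ := wedge_oneForm₃_apply (fun j => a (τ (Fin.castAdd 4 j))) ![b (σ 0), b (σ 1), b (σ 2)]
  have h₄ := wedge_oneForm₄_apply (fun j => a (τ (Fin.natAdd 3 j)))
    ![b (σ 3), b (σ 4), b (σ 5), b (σ 6)]
  have h := det_perm_lower_minor (σ.trans τ.symm)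
  have hσ : Equiv.Perm.sign (σ.trans τ.symm) = Equiv.Perm.sign σ := by
    rw [Equiv.Perm.sign_trans, Equiv.Perm.sign_symm, hτ, one_mul]
  rw [hσ] at h
  have e₃ : ∀ i : Fin 3, ![b (σ 0), b (σ 1), b (σ 2)] i = b (σ (Fin.castAdd 4 i)) := by
    intro i; fin_cases i <;> rfl
  have e₄ : ∀ i : Fin 4, ![b (σ 3), b (σ 4), b (σ 5), b (σ 6)] i = b (σ (Fin.natAdd 3 i)) := by
    intro i; fin_cases i <;> rfl
  have hab' : ∀ i j, a i (b j) = if j = i then 1 else 0 := fun i j => by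
    simp only [hab, eq_comm]
  simp only [e₃, hab'] at h₃
  simp only [e₄, hab'] at h₄
  simp only [Equiv.trans_apply, Equiv.symm_apply_eq] at h
  rw [← h₃, ← h₄] at h
  exact h

end Hodge

section AdaptedCoframe

variable {V : Type*} [AddCommGroup V] [Module ℝ V] [TopologicalSpace V]

/-- The `i`-th coordinate 1-form of a coframe. -/
def coframeForm (e : V ≃L[ℝ] EuclideanSpace ℝ (Fin 7)) (i : Fin 7) : V [⋀^Fin 1]→L[ℝ] ℝ :=
  (coordForm i).compContinuousLinearMap (e : V →L[ℝ] EuclideanSpace ℝ (Fin 7))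

/-- `e^i ∧ e^j` for a coframe. -/
def coframeForm₂ (e : V ≃L[ℝ] EuclideanSpace ℝ (Fin 7)) (i j : Fin 7) : V [⋀^Fin 2]→L[ℝ] ℝ :=
  wedge (coframeForm e i) (coframeForm e j)

/-- `e^i ∧ e^j ∧ e^k` for a coframe. -/
def coframeForm₃ (e : V ≃L[ℝ] EuclideanSpace ℝ (Fin 7)) (i j k : Fin 7) : V [⋀^Fin 3]→L[ℝ] ℝ :=
  wedge (coframeForm₂ e i j) (coframeForm e k)

/-- `e^i ∧ e^j ∧ e^k ∧ e^l` for a coframe. -/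
def coframeForm₄ (e : V ≃L[ℝ] EuclideanSpace ℝ (Fin 7)) (i j k l : Fin 7) :
    V [⋀^Fin 4]→L[ℝ] ℝ :=
  wedge (coframeForm₃ e i j k) (coframeForm e l)

variable (e : V ≃L[ℝ] EuclideanSpace ℝ (Fin 7))

theorem coframeForm_eq_oneForm (i : Fin 7) :
    coframeForm e i = oneForm ((EuclideanSpace.proj i : EuclideanSpace ℝ (Fin 7) →L[ℝ] ℝ).comp
      (e : V →L[ℝ] EuclideanSpace ℝ (Fin 7))) := rfl

theorem coframeForm₂_apply (i j : Fin 7) (v : Fin 2 → V) :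
    coframeForm₂ e i j v = e (v 0) i * e (v 1) j - e (v 1) i * e (v 0) j := by
  rw [coframeForm₂, coframeForm_eq_oneForm, coframeForm_eq_oneForm, wedge_oneForm₂_apply]
  rfl

/-- The standard form in an adapted coframe. -/
theorem stdG2Form_comp :
    stdG2Form.compContinuousLinearMap (e : V →L[ℝ] EuclideanSpace ℝ (Fin 7))
      = coframeForm₃ e 0 1 2 + coframeForm₃ e 0 3 4 + coframeForm₃ e 0 5 6
        + coframeForm₃ e 1 3 5 - coframeForm₃ e 1 4 6 - coframeForm₃ e 2 3 6
        - coframeForm₃ e 2 4 5 := by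
  have h : ∀ i j k, (coordForm₃ i j k).compContinuousLinearMap
      (e : V →L[ℝ] EuclideanSpace ℝ (Fin 7)) = coframeForm₃ e i j k := by
    intro i j k
    rw [coordForm₃, wedge_compContinuousLinearMap, wedge_compContinuousLinearMap]
    rfl
  have h' : ∀ (i j k : Fin 7) (v : Fin 3 → V),
      coordForm₃ i j k ((e : V →L[ℝ] EuclideanSpace ℝ (Fin 7)) ∘ v) = coframeForm₃ e i j k v :=
    fun i j k v => by rw [← h]; rfl
  ext v
  rw [ContinuousAlternatingMap.compContinuousLinearMap_apply]
  simp only [stdG2Form, ContinuousAlternatingMap.add_apply, ContinuousAlternatingMap.sub_apply, h']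

theorem isHodgeDual_coframeForm (τ : Equiv.Perm (Fin 7)) (hτ : Equiv.Perm.sign τ = 1) :
    IsHodgeDual (dualFrame e) (coframeForm₃ e (τ 0) (τ 1) (τ 2))
      (coframeForm₄ e (τ 3) (τ 4) (τ 5) (τ 6)) :=
  isHodgeDual_monomial (a := fun i => (EuclideanSpace.proj i :
      EuclideanSpace ℝ (Fin 7) →L[ℝ] ℝ).comp (e : V →L[ℝ] EuclideanSpace ℝ (Fin 7)))
    (fun i j => by simp [dualFrame]) τ hτ

/-- The dual 4-form in an adapted coframe. Each monomial is the complement of one in the 3-form, by an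
even permutation of the indices. -/
theorem isHodgeDual_stdG2Form :
    IsHodgeDual (dualFrame e)
      (stdG2Form.compContinuousLinearMap (e : V →L[ℝ] EuclideanSpace ℝ (Fin 7)))
      (coframeForm₄ e 3 4 5 6 + coframeForm₄ e 1 2 5 6 + coframeForm₄ e 1 2 3 4
        + coframeForm₄ e 0 2 4 6 - coframeForm₄ e 0 2 3 5 - coframeForm₄ e 0 1 4 5
        - coframeForm₄ e 0 1 3 6) := by
  rw [stdG2Form_comp]
  have h₁ : IsHodgeDual (dualFrame e) (coframeForm₃ e 0 1 2) (coframeForm₄ e 3 4 5 6) :=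
    isHodgeDual_coframeForm e 1 rfl
  have h₂ : IsHodgeDual (dualFrame e) (coframeForm₃ e 0 3 4) (coframeForm₄ e 1 2 5 6) :=
    isHodgeDual_coframeForm e ⟨![0, 3, 4, 1, 2, 5, 6], ![0, 3, 4, 1, 2, 5, 6],
    by decide, by decide⟩ (by decide)
  have h₃ : IsHodgeDual (dualFrame e) (coframeForm₃ e 0 5 6) (coframeForm₄ e 1 2 3 4) :=
    isHodgeDual_coframeForm e ⟨![0, 5, 6, 1, 2, 3, 4], ![0, 3, 4, 5, 6, 1, 2],
    by decide, by decide⟩ (by decide)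
  have h₄ : IsHodgeDual (dualFrame e) (coframeForm₃ e 1 3 5) (coframeForm₄ e 0 2 4 6) :=
    isHodgeDual_coframeForm e ⟨![1, 3, 5, 0, 2, 4, 6], ![3, 0, 4, 1, 5, 2, 6],
    by decide, by decide⟩ (by decide)
  have h₅ : IsHodgeDual (dualFrame e) (coframeForm₃ e 1 4 6) (coframeForm₄ e 0 2 3 5) :=
    isHodgeDual_coframeForm e ⟨![1, 4, 6, 0, 2, 3, 5], ![3, 0, 4, 5, 1, 6, 2],
    by decide, by decide⟩ (by decide)
  have h₆ : IsHodgeDual (dualFrame e) (coframeForm₃ e 2 3 6) (coframeForm₄ e 0 1 4 5) :=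
    isHodgeDual_coframeForm e ⟨![2, 3, 6, 0, 1, 4, 5], ![3, 4, 0, 1, 5, 6, 2],
    by decide, by decide⟩ (by decide)
  have h₇ : IsHodgeDual (dualFrame e) (coframeForm₃ e 2 4 5) (coframeForm₄ e 0 1 3 6) :=
    isHodgeDual_coframeForm e ⟨![2, 4, 5, 0, 1, 3, 6], ![3, 4, 0, 5, 1, 2, 6],
    by decide, by decide⟩ (by decide)
  exact (((((h₁.add h₂).add h₃).add h₄).sub h₅).sub h₆).sub h₇

end AdaptedCoframe

/-! ### Coframes adapted to the ansatz -/

section Ansatz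

variable {V : Type*} [AddCommGroup V] [Module ℝ V] [TopologicalSpace V]

/-- The coframe `e` is `(t² dt, t⁻¹ ξ, t⁻¹ η, t f⁰, t f¹, t f², t f³)`, where
`w₃ = f⁰ ∧ f¹ + f² ∧ f³`, `w₂ = f⁰ ∧ f² - f¹ ∧ f³` and `w₁ = -(f⁰ ∧ f³ + f¹ ∧ f²)`. -/
structure IsAnsatzCoframe (e : V ≃L[ℝ] EuclideanSpace ℝ (Fin 7)) (t : ℝ)
    (dt ξ η : V [⋀^Fin 1]→L[ℝ] ℝ) (w₁ w₂ w₃ : V [⋀^Fin 2]→L[ℝ] ℝ) : Prop where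
  ne_zero : t ≠ 0
  dt_eq : dt = (t ^ 2)⁻¹ • coframeForm e 0
  ξ_eq : ξ = t • coframeForm e 1
  η_eq : η = t • coframeForm e 2
  w₁_eq : w₁ = -(t ^ 2)⁻¹ • (coframeForm₂ e 3 6 + coframeForm₂ e 4 5)
  w₂_eq : w₂ = (t ^ 2)⁻¹ • (coframeForm₂ e 3 5 + (-1 : ℝ) • coframeForm₂ e 4 6)
  w₃_eq : w₃ = (t ^ 2)⁻¹ • (coframeForm₂ e 3 4 + coframeForm₂ e 5 6)

variable (e : V ≃L[ℝ] EuclideanSpace ℝ (Fin 7))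

theorem wedge_coframeForm₂_coframeForm (i j k : Fin 7) :
    wedge (coframeForm₂ e i j) (coframeForm e k) = coframeForm₃ e i j k := rfl

theorem wedge_coframeForm₃_coframeForm (i j k l : Fin 7) :
    wedge (coframeForm₃ e i j k) (coframeForm e l) = coframeForm₄ e i j k l := rfl

theorem coframeForm₃_rotate (i j k : Fin 7) : coframeForm₃ e i j k = coframeForm₃ e k i j :=
  wedge_one_one_one_rotate _ _ _

theorem coframeForm₄_rotate (i j k l : Fin 7) :
    coframeForm₄ e i j k l = coframeForm₄ e k l i j :=
  wedge_four_rotate _ _ _ _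

theorem wedge_coframeForm₂ (i j k l : Fin 7) :
    wedge (coframeForm₂ e i j) (coframeForm₂ e k l) = coframeForm₄ e i j k l :=
  wedge_two_two_eq _ _ _ _

theorem coframeForm₄_swap (i j k l : Fin 7) :
    coframeForm₄ e i j k l = -coframeForm₄ e i j l k := by
  rw [← wedge_coframeForm₃_coframeForm, ← wedge_coframeForm₃_coframeForm,
    ← wedge_coframeForm₂_coframeForm, ← wedge_coframeForm₂_coframeForm,
    wedge_two_one_one_anticomm]

theorem coframeForm₄_swap' (i j k l : Fin 7) :
    coframeForm₄ e i j k l = -coframeForm₄ e i k j l := by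
  have h : coframeForm₃ e i j k = -coframeForm₃ e i k j := wedge_one_one_one_swap _ _ _
  rw [coframeForm₄, h, wedge_neg_left]
  rfl

variable {e} {t : ℝ} {dt ξ η : V [⋀^Fin 1]→L[ℝ] ℝ} {w₁ w₂ w₃ : V [⋀^Fin 2]→L[ℝ] ℝ}

/-- The coframe is adapted to the 3-form: `t² w₁, t² w₂, t² w₃` are constant combinations of products
of coframe elements, and the powers of `t` cancel. -/
theorem IsAnsatzCoframe.form_eq (h : IsAnsatzCoframe e t dt ξ η w₁ w₂ w₃) :
    (t • wedge w₁ η + wedge (wedge dt ξ) η + t ^ 4 • wedge w₃ dt + t • wedge w₂ ξ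
      : V [⋀^Fin 3]→L[ℝ] ℝ)
      = stdG2Form.compContinuousLinearMap (e : V →L[ℝ] EuclideanSpace ℝ (Fin 7)) := by
  have ht := h.ne_zero
  rw [h.dt_eq, h.ξ_eq, h.η_eq, h.w₁_eq, h.w₂_eq, h.w₃_eq, stdG2Form_comp]
  have h012 : wedge (wedge (coframeForm e 0) (coframeForm e 1)) (coframeForm e 2)
    = coframeForm₃ e 0 1 2 := rfl
  simp only [wedge_add_left, wedge_smul_left, wedge_smul_right, wedge_coframeForm₂_coframeForm,
    h012]
  rw [coframeForm₃_rotate e 3 6 2, coframeForm₃_rotate e 4 5 2, coframeForm₃_rotate e 3 4 0,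
    coframeForm₃_rotate e 5 6 0, coframeForm₃_rotate e 3 5 1, coframeForm₃_rotate e 4 6 1]
  ext v
  simp only [ContinuousAlternatingMap.add_apply, ContinuousAlternatingMap.sub_apply,
    ContinuousAlternatingMap.smul_apply, smul_eq_mul]
  field_simp
  ring

theorem IsAnsatzCoframe.wedge_w₁_w₁ (h : IsAnsatzCoframe e t dt ξ η w₁ w₂ w₃) :
    wedge w₁ w₁ = (2 * (t ^ 4)⁻¹) • coframeForm₄ e 3 4 5 6 := by
  have ht := h.ne_zero
  have z₁ : coframeForm₄ e 3 6 3 6 = 0 := by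
    rw [← wedge_coframeForm₂]; exact wedge_two_two_zero₂ _ _ _
  have z₂ : coframeForm₄ e 4 5 4 5 = 0 := by
    rw [← wedge_coframeForm₂]; exact wedge_two_two_zero₂ _ _ _
  have h₁ : coframeForm₄ e 3 6 4 5 = coframeForm₄ e 3 4 5 6 := by
    rw [coframeForm₄_swap', coframeForm₄_swap, neg_neg]
  rw [h.w₁_eq]
  simp only [wedge_add_left, wedge_add_right, wedge_smul_left, wedge_smul_right,
    wedge_coframeForm₂, z₁, z₂, coframeForm₄_rotate e 4 5 3 6, h₁]
  ext v
  simp only [ContinuousAlternatingMap.add_apply, ContinuousAlternatingMap.smul_apply, smul_eq_mul,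
    ContinuousAlternatingMap.coe_zero, Pi.zero_apply]
  field_simp
  ring

theorem IsAnsatzCoframe.wedge_w₂_w₂ (h : IsAnsatzCoframe e t dt ξ η w₁ w₂ w₃) :
    wedge w₂ w₂ = (2 * (t ^ 4)⁻¹) • coframeForm₄ e 3 4 5 6 := by
  have ht := h.ne_zero
  have z₁ : coframeForm₄ e 3 5 3 5 = 0 := by
    rw [← wedge_coframeForm₂]; exact wedge_two_two_zero₂ _ _ _
  have z₂ : coframeForm₄ e 4 6 4 6 = 0 := by
    rw [← wedge_coframeForm₂]; exact wedge_two_two_zero₂ _ _ _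
  have h₁ : coframeForm₄ e 3 5 4 6 = (-1 : ℝ) • coframeForm₄ e 3 4 5 6 := by
    rw [coframeForm₄_swap']
    ext v
    simp
  rw [h.w₂_eq]
  simp only [wedge_add_left, wedge_add_right, wedge_smul_left, wedge_smul_right,
    wedge_coframeForm₂, z₁, z₂, coframeForm₄_rotate e 4 6 3 5, h₁]
  ext v
  simp only [ContinuousAlternatingMap.add_apply, ContinuousAlternatingMap.smul_apply, smul_eq_mul,
    ContinuousAlternatingMap.coe_zero, Pi.zero_apply]
  field_simp
  ring

/-- The three Kähler forms are orthogonal and of equal length for the wedge product. The closedness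
of the dual form rests on this relation, `wedge_w₃_w₁` and `wedge_w₃_w₂`. -/
theorem IsAnsatzCoframe.wedge_w₁_w₁_eq (h : IsAnsatzCoframe e t dt ξ η w₁ w₂ w₃) :
    wedge w₁ w₁ = wedge w₂ w₂ := h.wedge_w₁_w₁.trans h.wedge_w₂_w₂.symm

theorem IsAnsatzCoframe.wedge_w₃_w₁ (h : IsAnsatzCoframe e t dt ξ η w₁ w₂ w₃) :
    wedge w₃ w₁ = 0 := by
  have z₁ : wedge (coframeForm₂ e 3 4) (coframeForm₂ e 3 6) = 0 := wedge_two_two_zero₂ _ _ _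
  have z₂ : wedge (coframeForm₂ e 3 4) (coframeForm₂ e 4 5) = 0 := wedge_two_two_zero₁ _ _ _
  have z₃ : wedge (coframeForm₂ e 5 6) (coframeForm₂ e 3 6) = 0 := wedge_two_two_zero₃ _ _ _
  have z₄ : wedge (coframeForm₂ e 5 6) (coframeForm₂ e 4 5) = 0 := wedge_two_two_zero₄ _ _ _
  rw [h.w₁_eq, h.w₃_eq]
  simp only [wedge_add_left, wedge_add_right, wedge_smul_left, wedge_smul_right, z₁, z₂, z₃, z₄,
    add_zero, smul_zero]

theorem IsAnsatzCoframe.wedge_w₃_w₂ (h : IsAnsatzCoframe e t dt ξ η w₁ w₂ w₃) :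
    wedge w₃ w₂ = 0 := by
  have z₁ : wedge (coframeForm₂ e 3 4) (coframeForm₂ e 3 5) = 0 := wedge_two_two_zero₂ _ _ _
  have z₂ : wedge (coframeForm₂ e 3 4) (coframeForm₂ e 4 6) = 0 := wedge_two_two_zero₁ _ _ _
  have z₃ : wedge (coframeForm₂ e 5 6) (coframeForm₂ e 3 5) = 0 := wedge_two_two_zero₄ _ _ _
  have z₄ : wedge (coframeForm₂ e 5 6) (coframeForm₂ e 4 6) = 0 := wedge_two_two_zero₃ _ _ _
  rw [h.w₂_eq, h.w₃_eq]
  simp only [wedge_add_left, wedge_add_right, wedge_smul_left, wedge_smul_right, z₁, z₂, z₃, z₄,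
    add_zero, smul_zero]

/-- Multiplied out in the coframe, the 4-form is the sum of monomials of `isHodgeDual_stdG2Form`. -/
theorem IsAnsatzCoframe.isHodgeDual (h : IsAnsatzCoframe e t dt ξ η w₁ w₂ w₃) :
    IsHodgeDual (dualFrame e)
      (stdG2Form.compContinuousLinearMap (e : V →L[ℝ] EuclideanSpace ℝ (Fin 7)))
      (wedge (wedge w₃ ξ) η - t ^ 3 • wedge (wedge w₂ dt) η + t ^ 3 • wedge (wedge w₁ dt) ξ
        + ((1 / 2 : ℝ) * t ^ 4) • wedge w₁ w₁) := by
  have ht := h.ne_zero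
  convert isHodgeDual_stdG2Form e using 1
  rw [h.wedge_w₁_w₁, h.dt_eq, h.ξ_eq, h.η_eq, h.w₁_eq, h.w₂_eq, h.w₃_eq]
  simp only [wedge_add_left, wedge_smul_left, wedge_smul_right, wedge_coframeForm₂_coframeForm,
    wedge_coframeForm₃_coframeForm]
  rw [coframeForm₄_rotate e 3 4 1 2, coframeForm₄_rotate e 5 6 1 2, coframeForm₄_rotate e 3 5 0 2,
    coframeForm₄_rotate e 4 6 0 2, coframeForm₄_rotate e 3 6 0 1, coframeForm₄_rotate e 4 5 0 1]
  ext v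
  simp only [ContinuousAlternatingMap.add_apply, ContinuousAlternatingMap.sub_apply,
    ContinuousAlternatingMap.smul_apply, smul_eq_mul]
  field_simp
  ring

end Ansatz

/-! ### Quaternionic frames -/

section QuaternionicFrame

variable {W : Type*} [AddCommGroup W] [Module ℝ W] [TopologicalSpace W]

/-- In a 4-dimensional Euclidean space with orthogonal complex structures satisfying the quaternion
relations, a unit vector `f₀` gives the orthonormal basis `f₀, J₃ f₀, J₂ f₀, -J₁ f₀`, in which the
three Kähler forms have constant coefficients. -/
theorem exists_quaternionic_frame (hW : Module.finrank ℝ W = 4) (g : W →L[ℝ] W →L[ℝ] ℝ)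
    (hsymm : ∀ u v, g u v = g v u) (hpos : ∀ u, u ≠ 0 → 0 < g u u) (J₁ J₂ J₃ : W →L[ℝ] W)
    (h₁ : ∀ u, J₁ (J₁ u) = -u) (h₂ : ∀ u, J₂ (J₂ u) = -u) (h₃ : ∀ u, J₃ (J₃ u) = -u)
    (h₁₂ : ∀ u, J₁ (J₂ u) = J₃ u) (o₁ : ∀ u v, g (J₁ u) (J₁ v) = g u v)
    (o₂ : ∀ u v, g (J₂ u) (J₂ v) = g u v) (o₃ : ∀ u v, g (J₃ u) (J₃ v) = g u v) :
    ∃ f : Fin 4 → W, (∀ u, (∀ a, g (f a) u = 0) → u = 0) ∧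
      (∀ u v, g u v = ∑ a, g (f a) u * g (f a) v) ∧
      (∀ u v, g (J₁ u) v = -(g (f 0) u * g (f 3) v - g (f 0) v * g (f 3) u
        + (g (f 1) u * g (f 2) v - g (f 1) v * g (f 2) u))) ∧
      (∀ u v, g (J₂ u) v = g (f 0) u * g (f 2) v - g (f 0) v * g (f 2) u
        - (g (f 1) u * g (f 3) v - g (f 1) v * g (f 3) u)) ∧
      (∀ u v, g (J₃ u) v = g (f 0) u * g (f 1) v - g (f 0) v * g (f 1) u
        + (g (f 2) u * g (f 3) v - g (f 2) v * g (f 3) u)) := by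
  -- anticommutation
  have h₂₁ : ∀ u, J₂ (J₁ u) = -J₃ u := by
    intro u
    have h := h₃ (J₂ u)
    rw [← h₁₂ (J₂ u), ← h₁₂, h₂, map_neg, map_neg, map_neg, neg_inj] at h
    have h' := congrArg J₁ h
    rw [h₁, h₁₂] at h'
    rw [← h', neg_neg]
  have h₁₃ : ∀ u, J₁ (J₃ u) = -J₂ u := fun u => by rw [← h₁₂, h₁]
  have h₃₂ : ∀ u, J₃ (J₂ u) = -J₁ u := fun u => by rw [← h₁₂, h₂, map_neg]
  have h₂₃ : ∀ u, J₂ (J₃ u) = J₁ u := fun u => by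
    rw [← h₁₂, h₂₁, h₃₂, neg_neg]
  have h₃₁ : ∀ u, J₃ (J₁ u) = J₂ u := fun u => by
    rw [← h₁₂, h₂₁, map_neg, h₁₃, neg_neg]
  -- orthogonality
  have p₁ : ∀ u, g (J₁ u) u = 0 := fun u => by
    have h := o₁ (J₁ u) u
    rw [h₁, map_neg, neg_apply, hsymm] at h
    linarith
  have p₂ : ∀ u, g (J₂ u) u = 0 := fun u => by
    have h := o₂ (J₂ u) u
    rw [h₂, map_neg, neg_apply, hsymm] at h
    linarith
  have p₃ : ∀ u, g (J₃ u) u = 0 := fun u => by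
    have h := o₃ (J₃ u) u
    rw [h₃, map_neg, neg_apply, hsymm] at h
    linarith
  have p₃₂ : ∀ u, g (J₃ u) (J₂ u) = 0 := fun u => by rw [← h₁₂]; exact p₁ _
  have p₃₁ : ∀ u, g (J₃ u) (J₁ u) = 0 := fun u => by
    have h := p₂ (J₁ u)
    rw [h₂₁, map_neg, neg_apply] at h
    linarith
  have p₂₁ : ∀ u, g (J₂ u) (J₁ u) = 0 := fun u => by rw [← h₃₁]; exact p₃ _
  -- a unit vector
  have : Module.Finite ℝ W := Module.finite_of_finrank_eq_succ hW
  have : Nontrivial W := Module.nontrivial_of_finrank_pos (R := ℝ) (by omega)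
  obtain ⟨x, hx⟩ := exists_ne (0 : W)
  obtain ⟨z, hz⟩ : ∃ z, g z z = 1 := by
    refine ⟨(Real.sqrt (g x x))⁻¹ • x, ?_⟩
    have hs := Real.mul_self_sqrt (hpos x hx).le
    have hs0 : Real.sqrt (g x x) ≠ 0 := (Real.sqrt_pos.2 (hpos x hx)).ne'
    simp only [map_smul, smul_apply, smul_eq_mul]
    field_simp
    nlinarith
  set f : Fin 4 → W := ![z, J₃ z, J₂ z, -J₁ z] with hf
  have horth : ∀ a b, g (f a) (f b) = if a = b then 1 else 0 := by
    have q₁ := p₁ z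
    have q₂ := p₂ z
    have q₃ := p₃ z
    have q₃₂ := p₃₂ z
    have q₃₁ := p₃₁ z
    have q₂₁ := p₂₁ z
    have r₁ := (hsymm z (J₁ z)).trans q₁
    have r₂ := (hsymm z (J₂ z)).trans q₂
    have r₃ := (hsymm z (J₃ z)).trans q₃
    have r₃₂ := (hsymm (J₂ z) (J₃ z)).trans q₃₂
    have r₃₁ := (hsymm (J₁ z) (J₃ z)).trans q₃₁
    have r₂₁ := (hsymm (J₁ z) (J₂ z)).trans q₂₁
    intro a b
    fin_cases a <;> fin_cases b <;>
      simp [hf, q₁, q₂, q₃, q₃₂, q₃₁, q₂₁, r₁, r₂, r₃, r₃₂, r₃₁, r₂₁, hz, o₁, o₂, o₃]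
  have hli : LinearIndependent ℝ f := by
    rw [Fintype.linearIndependent_iff]
    intro c hc a
    have h := congrArg (g (f a)) hc
    simpa [map_sum, horth] using h
  let bas := basisOfLinearIndependentOfCardEqFinrank hli (by simp [hW])
  have hexp : ∀ u, u = ∑ a, g (f a) u • f a := by
    intro u
    have hu := bas.sum_repr u
    simp only [bas, coe_basisOfLinearIndependentOfCardEqFinrank] at hu
    have hc : ∀ a, g (f a) u = bas.repr u a := by
      intro a
      conv_lhs => rw [← hu]
      simp [map_sum, horth, bas]
    simp only [hc]
    exact hu.symm
  have hJ₃ : ∀ u, J₃ u = g (f 0) u • f 1 - g (f 1) u • f 0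
      + (g (f 2) u • f 3 - g (f 3) u • f 2) := by
    intro u
    conv_lhs => rw [hexp u]
    simp only [Fin.sum_univ_four, map_add, map_smul]
    simp only [hf, Matrix.cons_val, map_neg, h₃, h₃₂, h₃₁]
    module
  have hJ₂ : ∀ u, J₂ u = g (f 0) u • f 2 - g (f 2) u • f 0
      - (g (f 1) u • f 3 - g (f 3) u • f 1) := by
    intro u
    conv_lhs => rw [hexp u]
    simp only [Fin.sum_univ_four, map_add, map_smul]
    simp only [hf, Matrix.cons_val, map_neg, h₂, h₂₃, h₂₁]
    module
  have hJ₁ : ∀ u, J₁ u = -(g (f 0) u • f 3 - g (f 3) u • f 0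
      + (g (f 1) u • f 2 - g (f 2) u • f 1)) := by
    intro u
    conv_lhs => rw [hexp u]
    simp only [Fin.sum_univ_four, map_add, map_smul]
    simp only [hf, Matrix.cons_val, map_neg, h₁, h₁₂, h₁₃]
    module
  refine ⟨f, fun u hu => ?_, fun u v => ?_, fun u v => ?_, fun u v => ?_, fun u v => ?_⟩
  · rw [hexp u]; simp [hu]
  · conv_lhs => rw [hexp u]
    simp [map_sum, sum_apply]
  · rw [hJ₁]
    simp only [map_add, map_sub, map_neg, map_smul, add_apply, sub_apply, neg_apply, smul_apply,
      smul_eq_mul]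
    ring
  · rw [hJ₂]
    simp only [map_sub, map_smul, sub_apply, smul_apply, smul_eq_mul]
    ring
  · rw [hJ₃]
    simp only [map_add, map_sub, map_smul, add_apply, sub_apply, smul_apply, smul_eq_mul]
    ring

end QuaternionicFrame

section Coframe

/-- Seven functionals without a common zero on `ℝ⁷` are the coordinates of a coframe. -/
theorem exists_coframe (a : Fin 7 → EuclideanSpace ℝ (Fin 7) →L[ℝ] ℝ)
    (h : ∀ u, (∀ i, a i u = 0) → u = 0) :
    ∃ e : EuclideanSpace ℝ (Fin 7) ≃L[ℝ] EuclideanSpace ℝ (Fin 7), ∀ u i, e u i = a i u := by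
  let L : EuclideanSpace ℝ (Fin 7) →ₗ[ℝ] EuclideanSpace ℝ (Fin 7) :=
    (WithLp.linearEquiv 2 ℝ (Fin 7 → ℝ)).symm.toLinearMap ∘ₗ
      LinearMap.pi fun i => (a i : EuclideanSpace ℝ (Fin 7) →ₗ[ℝ] ℝ)
  have hL : ∀ u i, L u i = a i u := fun u i => rfl
  have hinj : Function.Injective L := by
    rw [injective_iff_map_eq_zero]
    intro u hu
    exact h u fun i => by rw [← hL, hu]; rfl
  exact ⟨(LinearEquiv.ofInjectiveEndo L hinj).toContinuousLinearEquiv, fun u i => hL u i⟩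

end Coframe

section AnsatzCoframe

variable {W : Type*} [AddCommGroup W] [Module ℝ W] [TopologicalSpace W]

/-- The coframe `(t² dt, t⁻¹ ξ, t⁻¹ η, t f⁰, …, t f³)` is adapted to the 3-form and orthonormal for the
Gibbons–Lü–Pope–Stelle metric. Here `D` is the derivative of the projection to the hyperkähler
manifold, `W` is the tangent space of the latter and the `fᵃ` come from a quaternionic frame of
`W`. -/
theorem exists_isAnsatzCoframe (hW : Module.finrank ℝ W = 4) (g : W →L[ℝ] W →L[ℝ] ℝ)
    (hsymm : ∀ u v, g u v = g v u) (hpos : ∀ u, u ≠ 0 → 0 < g u u) (J₁ J₂ J₃ : W →L[ℝ] W)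
    (h₁ : ∀ u, J₁ (J₁ u) = -u) (h₂ : ∀ u, J₂ (J₂ u) = -u) (h₃ : ∀ u, J₃ (J₃ u) = -u)
    (h₁₂ : ∀ u, J₁ (J₂ u) = J₃ u) (o₁ : ∀ u v, g (J₁ u) (J₁ v) = g u v)
    (o₂ : ∀ u v, g (J₂ u) (J₂ v) = g u v) (o₃ : ∀ u v, g (J₃ u) (J₃ v) = g u v)
    (ω₁ ω₂ ω₃ : W [⋀^Fin 2]→L[ℝ] ℝ) (hω₁ : ∀ u v, ω₁ ![u, v] = g (J₁ u) v)
    (hω₂ : ∀ u v, ω₂ ![u, v] = g (J₂ u) v) (hω₃ : ∀ u v, ω₃ ![u, v] = g (J₃ u) v)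
    (D : EuclideanSpace ℝ (Fin 7) →L[ℝ] W) {t : ℝ} (ht : t ≠ 0)
    (dt ξ η : EuclideanSpace ℝ (Fin 7) [⋀^Fin 1]→L[ℝ] ℝ)
    (hinj : ∀ u, D u = 0 → (dt fun _ => u) = 0 → (ξ fun _ => u) = 0 → (η fun _ => u) = 0 → u = 0) :
    ∃ e : EuclideanSpace ℝ (Fin 7) ≃L[ℝ] EuclideanSpace ℝ (Fin 7),
      IsAnsatzCoframe e t dt ξ η (ω₁.compContinuousLinearMap D) (ω₂.compContinuousLinearMap D)
        (ω₃.compContinuousLinearMap D) ∧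
      ∀ u v, t ^ 2 * g (D u) (D v) + (t ^ 2)⁻¹ * (ξ ![u] * ξ ![v])
        + (t ^ 2)⁻¹ * (η ![u] * η ![v]) + t ^ 4 * (dt ![u] * dt ![v]) = inner ℝ (e u) (e v) := by
  obtain ⟨f, hf, hg, hg₁, hg₂, hg₃⟩ :=
    exists_quaternionic_frame hW g hsymm hpos J₁ J₂ J₃ h₁ h₂ h₃ h₁₂ o₁ o₂ o₃
  -- `T` turns forms of degree one back into functionals
  let T := (ContinuousAlternatingMap.ofSubsingleton ℝ (EuclideanSpace ℝ (Fin 7)) ℝ (0 : Fin 1)).symm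
  have hT : ∀ (α : EuclideanSpace ℝ (Fin 7) [⋀^Fin 1]→L[ℝ] ℝ) v, T α (v 0) = α v := by
    intro α v
    change α (fun _ => v 0) = α v
    congr 1
    funext i
    rw [Subsingleton.elim i 0]
  obtain ⟨e, he⟩ := exists_coframe
    ![t ^ 2 • T dt, t⁻¹ • T ξ, t⁻¹ • T η, t • (g (f 0)).comp D, t • (g (f 1)).comp D,
      t • (g (f 2)).comp D, t • (g (f 3)).comp D] (by
      intro u hu
      have e₀ := hu 0
      have e₁ := hu 1
      have e₂ := hu 2
      have e₃ := hu 3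
      have e₄ := hu 4
      have e₅ := hu 5
      have e₆ := hu 6
      simp only [Matrix.cons_val, smul_apply, ContinuousLinearMap.comp_apply, smul_eq_mul,
        mul_eq_zero, ht, inv_eq_zero, pow_eq_zero_iff, ne_eq, OfNat.ofNat_ne_zero,
        not_false_eq_true, false_or] at e₀ e₁ e₂ e₃ e₄ e₅ e₆
      refine hinj u (hf _ fun a => ?_) e₀ e₁ e₂
      fin_cases a
      exacts [e₃, e₄, e₅, e₆])
  have e₀ : ∀ u, e u 0 = t ^ 2 * T dt u := fun u => he u 0
  have e₁ : ∀ u, e u 1 = t⁻¹ * T ξ u := fun u => he u 1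
  have e₂ : ∀ u, e u 2 = t⁻¹ * T η u := fun u => he u 2
  have e₃ : ∀ u, e u 3 = t * g (f 0) (D u) := fun u => he u 3
  have e₄ : ∀ u, e u 4 = t * g (f 1) (D u) := fun u => he u 4
  have e₅ : ∀ u, e u 5 = t * g (f 2) (D u) := fun u => he u 5
  have e₆ : ∀ u, e u 6 = t * g (f 3) (D u) := fun u => he u 6
  have hc : ∀ i v, coframeForm e i v = e (v 0) i := fun i v => rfl
  have hpull : ∀ (β : W [⋀^Fin 2]→L[ℝ] ℝ) (v : Fin 2 → EuclideanSpace ℝ (Fin 7)),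
      β.compContinuousLinearMap D v = β ![D (v 0), D (v 1)] := by
    intro β v
    change β (fun i => D (v i)) = _
    congr 1
    funext i
    fin_cases i <;> rfl
  refine ⟨e, ⟨ht, ?_, ?_, ?_, ?_, ?_, ?_⟩, ?_⟩
  · ext v
    rw [ContinuousAlternatingMap.smul_apply, hc, e₀, hT, smul_eq_mul]
    field_simp
  · ext v
    rw [ContinuousAlternatingMap.smul_apply, hc, e₁, hT, smul_eq_mul]
    field_simp
  · ext v
    rw [ContinuousAlternatingMap.smul_apply, hc, e₂, hT, smul_eq_mul]
    field_simp
  · ext v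
    rw [hpull, hω₁, hg₁]
    simp only [ContinuousAlternatingMap.smul_apply, ContinuousAlternatingMap.add_apply,
      coframeForm₂_apply, smul_eq_mul, e₃, e₄, e₅, e₆]
    field_simp
  · ext v
    rw [hpull, hω₂, hg₂]
    simp only [ContinuousAlternatingMap.smul_apply, ContinuousAlternatingMap.add_apply,
      coframeForm₂_apply, smul_eq_mul, e₃, e₄, e₅, e₆]
    field_simp
    ring
  · ext v
    rw [hpull, hω₃, hg₃]
    simp only [ContinuousAlternatingMap.smul_apply, ContinuousAlternatingMap.add_apply,
      coframeForm₂_apply, smul_eq_mul, e₃, e₄, e₅, e₆]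
    field_simp
  · intro u v
    rw [hg, PiLp.inner_apply]
    simp only [Fin.sum_univ_succ, Fin.sum_univ_zero, ← hT]
    simp [e₀, e₁, e₂, e₃, e₄, e₅, e₆]
    field_simp
    ring

end AnsatzCoframe

/-! ### The exterior derivatives of the 3-form and of its dual -/

section Closedness

variable {E : Type*} [NormedAddCommGroup E] [NormedSpace ℝ E]
  {Y : Type*} [TopologicalSpace Y] [ChartedSpace E Y] [IsManifold 𝓘(ℝ, E) ∞ Y]

omit [IsManifold 𝓘(ℝ, E) ∞ Y] in
/-- The chain rule `d(g ∘ t) = g'(t) dt`. -/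
theorem DForm.ofFun_comp {t : Y → ℝ} {y : Y} (ht : MDifferentiableAt 𝓘(ℝ, E) 𝓘(ℝ, ℝ) t y)
    {g : ℝ → ℝ} {g' : ℝ} (hg : HasDerivAt g g' (t y)) :
    DForm.ofFun (E := E) (fun y => g (t y)) y = g' • DForm.ofFun (E := E) t y := by
  have h := hg.hasFDerivAt.hasMFDerivAt.comp y ht.hasMFDerivAt
  ext v
  have h' := DFunLike.congr_fun h.mfderiv (v 0)
  exact h'.trans (mul_comm (G := ℝ) _ _)

variable {t : Y → ℝ} {ξ η : DForm E Y 1} {w₁ w₂ w₃ : DForm E Y 2}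

/-- The structure equations of the ansatz: `dξ = w₁`, `dη = -w₂` and `dwᵢ = 0`, for smooth objects
on a manifold of any dimension. -/
structure IsAnsatzSystem (t : Y → ℝ) (ξ η : DForm E Y 1) (w₁ w₂ w₃ : DForm E Y 2) : Prop where
  smooth_t : ContMDiff 𝓘(ℝ, E) 𝓘(ℝ, ℝ) ∞ t
  smooth_ξ : ξ.IsSmooth
  smooth_η : η.IsSmooth
  smooth_w₁ : w₁.IsSmooth
  smooth_w₂ : w₂.IsSmooth
  smooth_w₃ : w₃.IsSmooth
  d_ξ : ξ.d = w₁
  d_η : η.d = -w₂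
  d_w₁ : w₁.d = 0
  d_w₂ : w₂.d = 0
  d_w₃ : w₃.d = 0

variable (t ξ η w₁ w₂ w₃) in
/-- The 3-form `t w₁ ∧ η + dt ∧ ξ ∧ η + t⁴ w₃ ∧ dt + t w₂ ∧ ξ`. -/
def ansatzForm : DForm E Y 3 := fun y =>
  t y • wedge (w₁ y) (η y) + wedge (wedge (DForm.ofFun (E := E) t y) (ξ y)) (η y)
    + t y ^ 4 • wedge (w₃ y) (DForm.ofFun (E := E) t y) + t y • wedge (w₂ y) (ξ y)

variable (t ξ η w₁ w₂ w₃) in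
/-- The 4-form `w₃ ∧ ξ ∧ η - t³ w₂ ∧ dt ∧ η + t³ w₁ ∧ dt ∧ ξ + ½ t⁴ w₁ ∧ w₁`. -/
def ansatzDual : DForm E Y 4 := fun y =>
  wedge (wedge (w₃ y) (ξ y)) (η y) - t y ^ 3 • wedge (wedge (w₂ y) (DForm.ofFun (E := E) t y)) (η y)
    + t y ^ 3 • wedge (wedge (w₁ y) (DForm.ofFun (E := E) t y)) (ξ y)
    + ((1 / 2 : ℝ) * t y ^ 4) • wedge (w₁ y) (w₁ y)

namespace IsAnsatzSystem

variable (h : IsAnsatzSystem t ξ η w₁ w₂ w₃)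
include h

theorem smooth_dt : (DForm.ofFun (E := E) t).IsSmooth := DForm.isSmooth_ofFun h.smooth_t

omit [IsManifold 𝓘(ℝ, E) ∞ Y] in
theorem smooth_comp {g : ℝ → ℝ} (hg : ContDiff ℝ ∞ g) :
    ContMDiff 𝓘(ℝ, E) 𝓘(ℝ, ℝ) ∞ (fun y => g (t y)) := hg.contMDiff.comp h.smooth_t

/-- The Leibniz rule `d(g(t) α) = g(t) dα + (-1)^k g'(t) α ∧ dt`. -/
theorem d_comp_smul {k : ℕ} {g g' : ℝ → ℝ} (hg : ContDiff ℝ ∞ g)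
    (hg' : ∀ s, HasDerivAt g (g' s) s) {α : DForm E Y k} (hα : α.IsSmooth) (y : Y) :
    DForm.d (E := E) (fun y => g (t y) • α y) y
      = g (t y) • α.d y
        + ((-1 : ℝ) ^ k * g' (t y)) • wedge (α y) (DForm.ofFun (E := E) t y) := by
  rw [DForm.d_smul_apply (h.smooth_comp hg) hα,
    DForm.ofFun_comp ((h.smooth_t y).mdifferentiableAt (by simp)) (hg' (t y)), wedge_smul_right,
    smul_smul]

theorem d_wedge_w₁_η (y : Y) :
    DForm.d (E := E) (fun y => wedge (w₁ y) (η y)) y = -wedge (w₁ y) (w₂ y) := by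
  rw [DForm.d_wedge_apply h.smooth_w₁ h.smooth_η y HEq.rfl, h.d_w₁, h.d_η, Pi.neg_apply,
    wedge_neg_right]
  rw [Pi.zero_apply, wedge_zero_left]
  ext v
  simp

theorem d_wedge_w₂_ξ (y : Y) :
    DForm.d (E := E) (fun y => wedge (w₂ y) (ξ y)) y = wedge (w₂ y) (w₁ y) := by
  rw [DForm.d_wedge_apply h.smooth_w₂ h.smooth_ξ y HEq.rfl, h.d_w₂, h.d_ξ, Pi.zero_apply,
    wedge_zero_left]
  ext v
  simp

theorem d_wedge_w₃_ξ (y : Y) :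
    DForm.d (E := E) (fun y => wedge (w₃ y) (ξ y)) y = wedge (w₃ y) (w₁ y) := by
  rw [DForm.d_wedge_apply h.smooth_w₃ h.smooth_ξ y HEq.rfl, h.d_w₃, h.d_ξ, Pi.zero_apply,
    wedge_zero_left]
  ext v
  simp

theorem d_wedge_dt_ξ (y : Y) :
    DForm.d (E := E) (fun y => wedge (DForm.ofFun (E := E) t y) (ξ y)) y
      = -wedge (DForm.ofFun (E := E) t y) (w₁ y) := by
  rw [DForm.d_wedge_apply h.smooth_dt h.smooth_ξ y HEq.rfl, DForm.d_ofFun h.smooth_t, h.d_ξ,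
    Pi.zero_apply, wedge_zero_left]
  ext v
  simp

omit h in
theorem d_wedge_dt (ht : ContMDiff 𝓘(ℝ, E) 𝓘(ℝ, ℝ) ∞ t) {w : DForm E Y 2} (hw : w.IsSmooth)
    (hdw : w.d = 0) (y : Y) :
    DForm.d (E := E) (fun y => wedge (w y) (DForm.ofFun (E := E) t y)) y = 0 := by
  rw [DForm.d_wedge_apply hw (DForm.isSmooth_ofFun ht) y HEq.rfl, DForm.d_ofFun ht, hdw,
    Pi.zero_apply, wedge_zero_left, Pi.zero_apply, wedge_zero_right]
  ext v
  simp

theorem d_wedge_dt_ξ_η (y : Y) :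
    DForm.d (E := E) (fun y => wedge (wedge (DForm.ofFun (E := E) t y) (ξ y)) (η y)) y
      = -wedge (wedge (w₁ y) (DForm.ofFun (E := E) t y)) (η y)
        - wedge (wedge (w₂ y) (DForm.ofFun (E := E) t y)) (ξ y) := by
  rw [DForm.d_wedge_apply (h.smooth_dt.wedge h.smooth_ξ) h.smooth_η y HEq.rfl, h.d_wedge_dt_ξ,
    h.d_η, Pi.neg_apply, wedge_neg_right, wedge_neg_left, wedge_one_two_comm, wedge_one_one_two]
  ext v
  simp [sub_eq_add_neg]

/-- The terms `t w₁ ∧ w₂`, `w₁ ∧ η ∧ dt` and `w₂ ∧ ξ ∧ dt` of the derivative each occur twice, with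
opposite signs. -/
theorem d_ansatzForm : (ansatzForm t ξ η w₁ w₂ w₃).d = 0 := by
  have hA := h.smooth_w₁.wedge h.smooth_η
  have hB := (h.smooth_dt.wedge h.smooth_ξ).wedge h.smooth_η
  have hC := h.smooth_w₃.wedge h.smooth_dt
  have hD := h.smooth_w₂.wedge h.smooth_ξ
  have hA' := hA.smul h.smooth_t
  have hC' := hC.smul (h.smooth_comp (contDiff_id.pow 4))
  have hD' := hD.smul h.smooth_t
  have hsum := DForm.d_add ((hA'.add hB).add hC') hD'
  rw [DForm.d_add (hA'.add hB) hC', DForm.d_add hA' hB] at hsum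
  refine hsum.trans ?_
  funext y
  have e₁ := h.d_comp_smul (g := id) contDiff_id hasDerivAt_id hA y
  have e₂ := h.d_wedge_dt_ξ_η y
  have e₃ := h.d_comp_smul (contDiff_id.pow 4) (fun s => hasDerivAt_pow 4 s) hC y
  have e₄ := h.d_comp_smul (g := id) contDiff_id hasDerivAt_id hD y
  rw [h.d_wedge_w₁_η] at e₁
  rw [d_wedge_dt h.smooth_t h.smooth_w₃ h.d_w₃, wedge_two_one_one_self] at e₃
  rw [h.d_wedge_w₂_ξ] at e₄
  refine (congrArg₂ (· + ·) (congrArg₂ (· + ·) (congrArg₂ (· + ·) e₁ e₂) e₃) e₄).trans ?_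
  rw [wedge_two_one_one_anticomm (w₁ y) (η y), wedge_two_one_one_anticomm (w₂ y) (ξ y),
    wedge_two_two_comm (w₂ y) (w₁ y)]
  ext v
  simp only [ContinuousAlternatingMap.add_apply, ContinuousAlternatingMap.sub_apply,
    ContinuousAlternatingMap.smul_apply, ContinuousAlternatingMap.neg_apply, smul_eq_mul,
    ContinuousAlternatingMap.coe_zero, Pi.zero_apply, id]
  ring

theorem d_wedge_w₃_ξ_η (y : Y) (h₁ : wedge (w₃ y) (w₁ y) = 0) (h₂ : wedge (w₃ y) (w₂ y) = 0) :
    DForm.d (E := E) (fun y => wedge (wedge (w₃ y) (ξ y)) (η y)) y = 0 := by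
  rw [DForm.d_wedge_apply (h.smooth_w₃.wedge h.smooth_ξ) h.smooth_η y HEq.rfl, h.d_wedge_w₃_ξ,
    h.d_η, Pi.neg_apply, wedge_neg_right, wedge_two_one_two, h₁, h₂, wedge_zero_left,
    wedge_zero_left]
  ext v
  simp

theorem d_wedge_w₂_dt_η (y : Y) :
    DForm.d (E := E) (fun y => wedge (wedge (w₂ y) (DForm.ofFun (E := E) t y)) (η y)) y
      = wedge (wedge (w₂ y) (w₂ y)) (DForm.ofFun (E := E) t y) := by
  rw [DForm.d_wedge_apply (h.smooth_w₂.wedge h.smooth_dt) h.smooth_η y HEq.rfl,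
    d_wedge_dt h.smooth_t h.smooth_w₂ h.d_w₂,
    h.d_η, Pi.neg_apply, wedge_neg_right, wedge_two_one_two, wedge_zero_left]
  ext v
  simp [pow_succ]

theorem d_wedge_w₁_dt_ξ (y : Y) :
    DForm.d (E := E) (fun y => wedge (wedge (w₁ y) (DForm.ofFun (E := E) t y)) (ξ y)) y
      = -wedge (wedge (w₁ y) (w₁ y)) (DForm.ofFun (E := E) t y) := by
  rw [DForm.d_wedge_apply (h.smooth_w₁.wedge h.smooth_dt) h.smooth_ξ y HEq.rfl,
    d_wedge_dt h.smooth_t h.smooth_w₁ h.d_w₁,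
    h.d_ξ, wedge_two_one_two, wedge_zero_left]
  ext v
  simp [pow_succ]

theorem d_wedge_w₁_w₁ (y : Y) :
    DForm.d (E := E) (fun y => wedge (w₁ y) (w₁ y)) y = 0 := by
  refine (DForm.d_wedge_apply h.smooth_w₁ h.smooth_w₁ y (δ := 0) ?_).trans ?_
  · rw [h.d_w₁, Pi.zero_apply, wedge_zero_left]
  · rw [h.d_w₁, Pi.zero_apply, wedge_zero_right, smul_zero, add_zero]

theorem smooth_ansatzForm : (ansatzForm t ξ η w₁ w₂ w₃).IsSmooth :=
  ((((h.smooth_w₁.wedge h.smooth_η).smul h.smooth_t).add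
    ((h.smooth_dt.wedge h.smooth_ξ).wedge h.smooth_η)).add
    ((h.smooth_w₃.wedge h.smooth_dt).smul (h.smooth_comp (contDiff_id.pow 4)))).add
    ((h.smooth_w₂.wedge h.smooth_ξ).smul h.smooth_t)

theorem smooth_ansatzDual : (ansatzDual t ξ η w₁ w₂ w₃).IsSmooth :=
  ((((h.smooth_w₃.wedge h.smooth_ξ).wedge h.smooth_η).sub
    (((h.smooth_w₂.wedge h.smooth_dt).wedge h.smooth_η).smul
      (h.smooth_comp (contDiff_id.pow 3)))).add
    (((h.smooth_w₁.wedge h.smooth_dt).wedge h.smooth_ξ).smul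
      (h.smooth_comp (contDiff_id.pow 3)))).add
    ((h.smooth_w₁.wedge h.smooth_w₁).smul
      (h.smooth_comp (contDiff_const.mul (contDiff_id.pow 4))))

/-- The derivatives of the last three terms are `-t³ w₂ ∧ w₂ ∧ dt`, `-t³ w₁ ∧ w₁ ∧ dt` and
`2t³ w₁ ∧ w₁ ∧ dt`, because `w ∧ dt ∧ η ∧ dt = 0`; the first term is closed since `w₃ ∧ w₁` and
`w₃ ∧ w₂` vanish. -/
theorem d_ansatzDual (h₁ : ∀ y, wedge (w₃ y) (w₁ y) = 0) (h₂ : ∀ y, wedge (w₃ y) (w₂ y) = 0)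
    (h₃ : ∀ y, wedge (w₁ y) (w₁ y) = wedge (w₂ y) (w₂ y)) :
    (ansatzDual t ξ η w₁ w₂ w₃).d = 0 := by
  have hc₃ : ContDiff ℝ ∞ (fun s : ℝ => s ^ 3) := contDiff_id.pow 3
  have hc₄ : ContDiff ℝ ∞ (fun s : ℝ => 1 / 2 * s ^ 4) := contDiff_const.mul (contDiff_id.pow 4)
  have hA := (h.smooth_w₃.wedge h.smooth_ξ).wedge h.smooth_η
  have hB := (h.smooth_w₂.wedge h.smooth_dt).wedge h.smooth_η
  have hC := (h.smooth_w₁.wedge h.smooth_dt).wedge h.smooth_ξ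
  have hD := h.smooth_w₁.wedge h.smooth_w₁
  have hB' := hB.smul (h.smooth_comp hc₃)
  have hC' := hC.smul (h.smooth_comp hc₃)
  have hD' := hD.smul (h.smooth_comp hc₄)
  have hsum := DForm.d_add ((hA.sub hB').add hC') hD'
  rw [DForm.d_add (hA.sub hB') hC', DForm.d_sub hA hB'] at hsum
  refine hsum.trans ?_
  funext y
  have e₁ := h.d_wedge_w₃_ξ_η y (h₁ y) (h₂ y)
  have e₂ := h.d_comp_smul hc₃ (fun s => hasDerivAt_pow 3 s) hB y
  have e₃ := h.d_comp_smul hc₃ (fun s => hasDerivAt_pow 3 s) hC y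
  have e₄ := h.d_comp_smul hc₄ (fun s => (hasDerivAt_pow 4 s).const_mul (1 / 2)) hD y
  rw [h.d_wedge_w₂_dt_η, wedge_two_one_one_one_self] at e₂
  rw [h.d_wedge_w₁_dt_ξ, wedge_two_one_one_one_self] at e₃
  rw [h.d_wedge_w₁_w₁] at e₄
  refine (congrArg₂ (· + ·) (congrArg₂ (· + ·) (congrArg₂ (· - ·) e₁ e₂) e₃) e₄).trans ?_
  rw [h₃]
  ext v
  simp only [ContinuousAlternatingMap.add_apply, ContinuousAlternatingMap.sub_apply,
    ContinuousAlternatingMap.smul_apply, ContinuousAlternatingMap.neg_apply, smul_eq_mul,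
    ContinuousAlternatingMap.coe_zero, Pi.zero_apply]
  push_cast
  ring

end IsAnsatzSystem
end Closedness

/-! ### The Gibbons–Lü–Pope–Stelle structure -/

theorem HyperkahlerStructure.exists_isAnsatzCoframe
    {M : Type*} [TopologicalSpace M] [ChartedSpace (EuclideanSpace ℝ (Fin 4)) M]
    [IsManifold (𝓡 4) ∞ M] (H : HyperkahlerStructure M) (x : M)
    (D : EuclideanSpace ℝ (Fin 7) →L[ℝ] TangentSpace (𝓡 4) x) {t : ℝ} (ht : t ≠ 0)
    (dt ξ η : EuclideanSpace ℝ (Fin 7) [⋀^Fin 1]→L[ℝ] ℝ)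
    (hinj : ∀ u, D u = 0 → (dt fun _ => u) = 0 → (ξ fun _ => u) = 0 → (η fun _ => u) = 0 → u = 0) :
    ∃ e : EuclideanSpace ℝ (Fin 7) ≃L[ℝ] EuclideanSpace ℝ (Fin 7),
      IsAnsatzCoframe e t dt ξ η ((H.ω₁ x).compContinuousLinearMap D)
        ((H.ω₂ x).compContinuousLinearMap D) ((H.ω₃ x).compContinuousLinearMap D) ∧
      ∀ u v, t ^ 2 * H.g.inner x (D u) (D v) + (t ^ 2)⁻¹ * (ξ ![u] * ξ ![v])
        + (t ^ 2)⁻¹ * (η ![u] * η ![v]) + t ^ 4 * (dt ![u] * dt ![v]) = inner ℝ (e u) (e v) :=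
  _root_.exists_isAnsatzCoframe (W := TangentSpace (𝓡 4) x) finrank_euclideanSpace_fin
    (H.g.inner x) (H.g.symm x) (H.g.pos x) (H.J₁ x) (H.J₂ x) (H.J₃ x) (H.sq_J₁ x) (H.sq_J₂ x)
    (H.sq_J₃ x) (H.J₁_J₂ x) (H.orthogonal_J₁ x) (H.orthogonal_J₂ x) (H.orthogonal_J₃ x) _ _ _
    (H.ω₁_apply x) (H.ω₂_apply x) (H.ω₃_apply x) D ht dt ξ η hinj

end

theorem mainTheorem8
    -- the hyperkähler 4-manifold
    {M : Type*} [TopologicalSpace M] [ChartedSpace (EuclideanSpace ℝ (Fin 4)) M]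
    [IsManifold (𝓡 4) ∞ M] (H : HyperkahlerStructure M)
    -- the principal circle bundle over it, with a connection form of curvature `ω₁`
    {P : Type*} [TopologicalSpace P] [ChartedSpace (EuclideanSpace ℝ (Fin 5)) P]
    [IsManifold (𝓡 5) ∞ P] [MulAction Circle P] (π : P → M)
    (hπ : IsPrincipalCircleBundle (𝓡 5) (𝓡 4) π)
    (ξ : DForm (EuclideanSpace ℝ (Fin 5)) P 1) (hξ : IsConnectionForm ξ)
    (hdξ : ξ.d = H.ω₁.pullback π)
    -- the principal circle bundle over `ℝ⁺ × P`, with a connection form of curvature `-ω₂`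
    {Y : Type*} [TopologicalSpace Y] [ChartedSpace (EuclideanSpace ℝ (Fin 7)) Y]
    [IsManifold (𝓡 7) ∞ Y] [MulAction Circle Y] (ρ : Y → posReals × P)
    (hρ : IsPrincipalCircleBundle (𝓡 7) (𝓘(ℝ, ℝ).prod (𝓡 5)) ρ)
    (η : DForm (EuclideanSpace ℝ (Fin 7)) Y 1) (hη : IsConnectionForm η)
    (hdη : η.d = -H.ω₂.pullback (fun y => π (ρ y).2)) :
    -- the objects on `ℝ⁺ × P` and `M`, pulled back to `Y`
    let t : Y → ℝ := fun y => ((ρ y).1 : ℝ)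
    let dt : DForm (EuclideanSpace ℝ (Fin 7)) Y 1 := DForm.ofFun t
    let ξY : DForm (EuclideanSpace ℝ (Fin 7)) Y 1 := ξ.pullback (fun y => (ρ y).2)
    let q : Y → M := fun y => π (ρ y).2
    let w₁ : DForm (EuclideanSpace ℝ (Fin 7)) Y 2 := H.ω₁.pullback q
    let w₂ : DForm (EuclideanSpace ℝ (Fin 7)) Y 2 := H.ω₂.pullback q
    let w₃ : DForm (EuclideanSpace ℝ (Fin 7)) Y 2 := H.ω₃.pullback q
    let φ : DForm (EuclideanSpace ℝ (Fin 7)) Y 3 := fun y =>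
      t y • wedge (w₁ y) (η y) + wedge (wedge (dt y) (ξY y)) (η y)
        + t y ^ 4 • wedge (w₃ y) (dt y) + t y • wedge (w₂ y) (ξY y)
    let ψ : DForm (EuclideanSpace ℝ (Fin 7)) Y 4 := fun y =>
      wedge (wedge (w₃ y) (ξY y)) (η y) - t y ^ 3 • wedge (wedge (w₂ y) (dt y)) (η y)
        + t y ^ 3 • wedge (wedge (w₁ y) (dt y)) (ξY y)
        + ((1 / 2 : ℝ) * t y ^ 4) • wedge (w₁ y) (w₁ y)
    let k : (y : Y) → TangentSpace (𝓡 7) y → TangentSpace (𝓡 7) y → ℝ := fun y u v =>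
      t y ^ 2 * H.g.inner (q y) (mfderiv (𝓡 7) (𝓡 4) q y u) (mfderiv (𝓡 7) (𝓡 4) q y v)
        + (t y ^ 2)⁻¹ * (ξY y ![u] * ξY y ![v]) + (t y ^ 2)⁻¹ * (η y ![u] * η y ![v])
        + t y ^ 4 * (dt y ![u] * dt y ![v])
    IsTorsionFreeG2Structure φ ∧ IsG2Dual φ ψ ∧ IsG2Metric φ k := by
  intro t dt ξY q w₁ w₂ w₃ φ ψ k
  have hρ₁ : ContMDiff (𝓡 7) 𝓘(ℝ, ℝ) ∞ (fun y => (ρ y).1) := contMDiff_fst.comp hρ.contMDiff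
  have hρ₂ : ContMDiff (𝓡 7) (𝓡 5) ∞ (fun y => (ρ y).2) := contMDiff_snd.comp hρ.contMDiff
  have ht : ContMDiff (𝓡 7) 𝓘(ℝ, ℝ) ∞ t := contMDiff_subtype_val.comp hρ₁
  have hq : ContMDiff (𝓡 7) (𝓡 4) ∞ q := hπ.contMDiff.comp hρ₂
  have hclosed : ∀ {α : DForm (EuclideanSpace ℝ (Fin 4)) M 2}, α.IsSmooth → α.d = 0 →
      (α.pullback (E := EuclideanSpace ℝ (Fin 7)) q).d = 0 := by
    intro α hα hdα
    rw [DForm.d_pullback hα hq, hdα]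
    rfl
  have hsys : IsAnsatzSystem t ξY η w₁ w₂ w₃ :=
    { smooth_t := ht
      smooth_ξ := hξ.smooth.pullback hρ₂
      smooth_η := hη.smooth
      smooth_w₁ := H.smooth_ω₁.pullback hq
      smooth_w₂ := H.smooth_ω₂.pullback hq
      smooth_w₃ := H.smooth_ω₃.pullback hq
      d_ξ := by
        rw [DForm.d_pullback hξ.smooth hρ₂, hdξ]
        funext y
        exact DForm.pullback_pullback_apply _ _ _ ((hπ.contMDiff _).mdifferentiableAt (by simp))
          ((hρ₂ y).mdifferentiableAt (by simp))
      d_η := hdη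
      d_w₁ := hclosed H.smooth_ω₁ H.closed_ω₁
      d_w₂ := hclosed H.smooth_ω₂ H.closed_ω₂
      d_w₃ := hclosed H.smooth_ω₃ H.closed_ω₃ }
  -- a vector killed by `dq`, `dt`, `ξ` and `η` vanishes: its image in `TP` is vertical for `π` and
  -- killed by `ξ`, its image in `T(ℝ⁺ × P)` is then zero, so that it is vertical for `ρ` and killed
  -- by `η`
  have hinj : ∀ (y : Y) (u : EuclideanSpace ℝ (Fin 7)),
      (mfderiv (𝓡 7) (𝓡 4) q y u : EuclideanSpace ℝ (Fin 4)) = 0 → (dt y fun _ => u) = 0 →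
      (ξY y fun _ => u) = 0 → (η y fun _ => u) = 0 → u = 0 := by
    intro y u hqu htu hξu hηu
    have hρd : MDifferentiableAt (𝓡 7) (𝓘(ℝ, ℝ).prod (𝓡 5)) ρ y :=
      (hρ.contMDiff y).mdifferentiableAt (by simp)
    have hρ₁d := (hρ₁ y).mdifferentiableAt (n := ∞) (by simp)
    have hρ₂d := (hρ₂ y).mdifferentiableAt (n := ∞) (by simp)
    let D₁ : EuclideanSpace ℝ (Fin 7) →L[ℝ] ℝ := mfderiv (𝓡 7) 𝓘(ℝ, ℝ) (fun y => (ρ y).1) y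
    let D₂ : EuclideanSpace ℝ (Fin 7) →L[ℝ] EuclideanSpace ℝ (Fin 5) :=
      mfderiv (𝓡 7) (𝓡 5) (fun y => (ρ y).2) y
    have hD₁ : D₁ u = 0 := by
      have hval : MDifferentiableAt 𝓘(ℝ, ℝ) 𝓘(ℝ, ℝ) (Subtype.val : posReals → ℝ) (ρ y).1 :=
        (contMDiff_subtype_val (n := ∞) _).mdifferentiableAt (by simp)
      have h := mfderiv_comp y hval hρ₁d
      have h' := DFunLike.congr_fun h u
      have h'' := DFunLike.congr_fun (mfderiv_posReals_val (ρ y).1) (D₁ u)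
      exact h''.symm.trans (h'.symm.trans htu)
    have hD₂ : D₂ u = 0 := by
      have h := mfderiv_comp y (g := π) ((hπ.contMDiff _).mdifferentiableAt (by simp)) hρ₂d
      have h' := DFunLike.congr_fun h u
      exact hπ.eq_zero_of_mfderiv_eq_zero hξ (h'.symm.trans hqu) hξu
    have hD : mfderiv (𝓡 7) (𝓘(ℝ, ℝ).prod (𝓡 5)) ρ y u = (D₁ u, D₂ u) :=
      DFunLike.congr_fun (mfderiv_prodMk hρ₁d hρ₂d) u
    refine hρ.eq_zero_of_mfderiv_eq_zero hη (hD.trans ?_) hηu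
    rw [hD₁, hD₂]
    rfl
  have hcoframe := fun y =>
    H.exists_isAnsatzCoframe (q y) (mfderiv (𝓡 7) (𝓡 4) q y) (t := t y) (ρ y).1.2.ne' (dt y)
      (ξY y) (η y) (hinj y)
  choose e he hk using hcoframe
  have hadapted : ∀ y, IsAdaptedCoframe (φ y) (e y) := fun y => (he y).form_eq
  have hdual : IsG2Dual φ ψ := by
    refine fun y => ⟨e y, hadapted y, ?_⟩
    have h := (he y).isHodgeDual
    rw [← (he y).form_eq] at h
    exact h
  exact ⟨⟨⟨hsys.smooth_ansatzForm, fun y => ⟨e y, hadapted y⟩⟩, hsys.d_ansatzForm,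
    ψ, hdual, hsys.smooth_ansatzDual, hsys.d_ansatzDual (fun y => (he y).wedge_w₃_w₁)
      (fun y => (he y).wedge_w₃_w₂) (fun y => (he y).wedge_w₁_w₁_eq)⟩,
    hdual, fun y => ⟨e y, hadapted y, hk y⟩⟩
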